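/- **Setting.** Let $k\ge 1$, $\mathbf n=(n_1,\dots,n_k)$ with $n_i\ge 1$, and let $\mathcal H$ be a complex Hilbert space. For an $n_i$-tuple $X_i=(X_{i,1},\dots,X_{i,n_i})$ of operators in $B(\mathcal H)$ let $\Phi_{X_i}(Y)=\sum_j X_{i,j}YX_{i,j}^*$, and for a word $\alpha=g_{j_1}\cdots g_{j_p}$ in the free monoid $\mathbb F_{n_i}^+$ on $n_i$ generators let $X_{i,\alpha}=X_{i,j_1}\cdots X_{i,j_p}$ (with $X_{i,\alpha}=I$ if $\alpha$ is empty), $|\alpha|=p$, and $\widetilde\alpha=g_{j_p}\cdots g_{j_1}$. The open regular polyball $\mathbf B_{\mathbf n}(\mathcal H)$ is the set of $\mathbf X=(X_1,\dots,X_k)$ such that the entries of $X_s$ commute with those of $X_t$ for $s\ne t$, $\|\sum_j X_{i,j}X_{i,j}^*\|^{1/2}<1$ for all $i$, and $\mathbf\Delta_{\mathbf X}(I)=(\mathrm{id}-\Phi_{X_1})\circ\cdots\circ(\mathrm{id}-\Phi_{X_k})(I)$ is positive and invertible. The closed polyball $\mathbf B_{\mathbf n}(\mathcal H)^-$ is its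 closure in the operator norm topology. The joint spectral radius is $r(A_i)=\lim_{p\to\infty}\|\sum_{|\beta|=p}A_{i,\beta}A_{i,\beta}^*\|^{1/2p}$. For $m\in\mathbb Z$ let $m^+=\max\{m,0\}$ and $m^-=\max\{-m,0\}$. A free $k$-pluriharmonic function with coefficients in $B(\mathcal E)$, $\mathcal E$ a separable Hilbert space, is a function $$F(\mathbf X)=\sum_{(m_1,\dots,m_k)\in\mathbb Z^k}\ \sum_{|\alpha_i|=m_i^-,\,|\beta_i|=m_i^+}A_{(\alpha_1,\dots,\alpha_k;\beta_1,\dots,\beta_k)}\otimes X_{1,\alpha_1}\cdots X_{k,\alpha_k}X_{1,\beta_1}^*\cdots X_{k,\beta_k}^*$$ whose series over $\mathbb Z^k$ converges in operator norm (in any order of summation) for every Hilbert space $\mathcal K$ and every $\mathbf X\in\mathbf B_{\mathbf n}(\mathcal K)$. It is positive if $F(\mathbf X)\ge 0$ for all such $\mathbf X$. Let $\mathbf R_{i,j}$ be the right creation operators on $\bigotimes_{i=1}^kF^2(H_{n_i})$ (full Fock spaces), $\mathbf R_{i,j}(e_{\alpha_1}\otimes\cdots\otimes e_{\alpha_k})=e_{\alpha_1}\otimes\cdots\otimes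 e_{\alpha_ig_j}\otimes\cdots\otimes e_{\alpha_k}$. The free pluriharmonic Poisson kernel $\boldsymbol{\mathcal P}(\mathbf R,\mathbf X)$ is the free $k$-pluriharmonic function with coefficients $\mathbf R_{1,\widetilde\alpha_1}^*\cdots\mathbf R_{k,\widetilde\alpha_k}^*\mathbf R_{1,\widetilde\beta_1}\cdots\mathbf R_{k,\widetilde\beta_k}$. For $\mathbf A,\mathbf B\in\mathbf B_{\mathbf n}(\mathcal H)^-$ write $\mathbf A\overset{H}{\prec}\mathbf B$ if there is $c>0$ with $F(r\mathbf A)\le c^2F(r\mathbf B)$ for all positive free $k$-pluriharmonic $F$ (all $\mathcal E$) and all $r\in[0,1)$, and $\mathbf A\overset{P}{\prec}\mathbf B$ if there is $c>0$ with $\boldsymbol{\mathcal P}(\mathbf R,r\mathbf A)\le c^2\boldsymbol{\mathcal P}(\mathbf R,r\mathbf B)$ for all $r\in[0,1)$. Harnack equivalence $\overset{H}{\sim}$ (Poisson equivalence $\overset{P}{\sim}$) means $\overset{H}{\prec}$ (respectively $\overset{P}{\prec}$) in both directions; its equivalence classes in $\mathbf B_{\mathbf n}(\mathcal H)^-$ are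 the Harnack (Poisson) parts. **Theorem.** Let $\mathbf A=(A_1,\dots,A_k)\in\mathbf B_{\mathbf n}(\mathcal H)^-$. The following are equivalent: 1. $\mathbf A\overset{H}{\sim}0$; 2. $r(A_i)<1$ for every $i\in\{1,\dots,k\}$, and there is $a>0$ such that $\boldsymbol{\mathcal P}(\mathbf R,r\mathbf A)\ge aI$ for all $r\in[0,1)$; 3. $\mathbf A\in\mathbf B_{\mathbf n}(\mathcal H)$; 4. $\mathbf A\overset{P}{\sim}0$. Consequently the Harnack part of $0$ and the Poisson part of $0$ in $\mathbf B_{\mathbf n}(\mathcal H)^-$ are both equal to $\mathbf B_{\mathbf n}(\mathcal H)$. -/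

import Mathlib

open scoped TensorProduct

noncomputable section

namespace Polyball

universe u v w

section Tensor

variable (E : Type v) [NormedAddCommGroup E] [InnerProductSpace ℂ E]
  (K : Type w) [NormedAddCommGroup K] [InnerProductSpace ℂ K]

/-- The Hilbert space tensor product of `E` and `K`: the completion of the algebraic tensor product
with respect to the inner product with `⟪x ⊗ y, x' ⊗ y'⟫ = ⟪x, x'⟫ * ⟪y, y'⟫`. -/
abbrev HTensor : Type (max v w) := UniformSpace.Completion (E ⊗[ℂ] K)

variable {E K}

/-- The bounded operator `S ⊗ T` on the Hilbert space tensor product. -/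
def opTensor (S : E →L[ℂ] E) (T : K →L[ℂ] K) : HTensor E K →L[ℂ] HTensor E K :=
  (TensorProduct.mapL S T).completion

theorem opTensor_coe_tmul (S : E →L[ℂ] E) (T : K →L[ℂ] K) (x : E) (y : K) :
    opTensor S T ((x ⊗ₜ[ℂ] y : E ⊗[ℂ] K) : HTensor E K)
      = ((S x ⊗ₜ[ℂ] T y : E ⊗[ℂ] K) : HTensor E K) := by
  simp [opTensor, ContinuousLinearMap.completion_apply_coe]

end Tensor

variable {k : ℕ}

/-- A `k`-tuple `X = (X_1, …, X_k)` where `X_i = (X_{i,1}, …, X_{i,n_i})` is an `n_i`-tuple of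
bounded operators on `K`. It carries the (product) operator norm topology. -/
abbrev OpTuple (n : Fin k → ℕ) (K : Type w) [NormedAddCommGroup K] [InnerProductSpace ℂ K] :
    Type w :=
  (i : Fin k) → Fin (n i) → (K →L[ℂ] K)

/-- `k`-tuples of words: elements of the product of the free monoids on `n_1, …, n_k` generators. -/
abbrev Words (n : Fin k → ℕ) : Type := (i : Fin k) → List (Fin (n i))

section Domain

variable (n : Fin k → ℕ) {K : Type w} [NormedAddCommGroup K] [InnerProductSpace ℂ K]

/-- `X_α = X_{j_1} ⋯ X_{j_p}` for a word `α = g_{j_1} ⋯ g_{j_p}` (and `I` for the empty word). -/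
def wordOp {m : ℕ} (T : Fin m → (K →L[ℂ] K)) (α : List (Fin m)) : K →L[ℂ] K :=
  (α.map T).prod

variable {n}

/-- `X_{1,α_1} X_{2,α_2} ⋯ X_{k,α_k}`. -/
def multiWordOp (X : OpTuple n K) (α : Words n) : K →L[ℂ] K :=
  (List.ofFn fun i => wordOp (X i) (α i)).prod

variable [CompleteSpace K]

/-- `X_{1,β_1}^* X_{2,β_2}^* ⋯ X_{k,β_k}^*`. -/
def multiWordOpStar (X : OpTuple n K) (β : Words n) : K →L[ℂ] K :=
  (List.ofFn fun i => star (wordOp (X i) (β i))).prod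

/-- `ρ` is the joint spectral radius of the tuple `T`, that is
`ρ = lim_{p → ∞} ‖∑_{|β| = p} T_β T_β^*‖^{1/(2p)}`. -/
def HasJointSpectralRadius {m : ℕ} (T : Fin m → (K →L[ℂ] K)) (ρ : ℝ) : Prop :=
  Filter.Tendsto
    (fun p : ℕ => ‖∑ β : Fin p → Fin m,
      wordOp T (List.ofFn β) * star (wordOp T (List.ofFn β))‖ ^ (1 / (2 * (p : ℝ))))
    Filter.atTop (nhds ρ)

/-- The map `Φ_T(Y) = ∑_j T_j Y T_j^*` on `B(K)`. -/
def Phi {m : ℕ} (T : Fin m → (K →L[ℂ] K)) : (K →L[ℂ] K) →ₗ[ℂ] (K →L[ℂ] K) :=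
  ∑ j, LinearMap.mulLeft ℂ (T j) ∘ₗ LinearMap.mulRight ℂ (star (T j))

theorem Phi_apply {m : ℕ} (T : Fin m → (K →L[ℂ] K)) (Y : K →L[ℂ] K) :
    Phi T Y = ∑ j, T j * Y * star (T j) := by
  simp [Phi, mul_assoc]

/-- The defect mapping `Δ_X = (id - Φ_{X_1}) ∘ ⋯ ∘ (id - Φ_{X_k})`. -/
def defectMap (X : OpTuple n K) : Module.End ℂ (K →L[ℂ] K) :=
  (List.ofFn fun i => (1 - Phi (X i) : Module.End ℂ (K →L[ℂ] K))).prod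

variable (n K)

/-- The open regular polyball `B_n(K)`: the entries of `X_s` commute with those of `X_t` for `s ≠ t`,
every `X_i` has row norm `‖∑_j X_{i,j} X_{i,j}^*‖^{1/2} < 1`, and `Δ_X(I)` is positive and
invertible. -/
def openPolyball : Set (OpTuple n K) :=
  {X | (∀ s t : Fin k, s ≠ t → ∀ a b, X s a * X t b = X t b * X s a) ∧
    (∀ i, Real.sqrt ‖∑ j, X i j * star (X i j)‖ < 1) ∧
    (defectMap X 1).IsPositive ∧ IsUnit (defectMap X 1)}

/-- The closed polyball `B_n(K)^-`: the operator norm closure of the open polyball. -/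
def closedPolyball : Set (OpTuple n K) := closure (openPolyball n K)

end Domain

section Pluriharmonic

variable {n : Fin k → ℕ} {E : Type v} [NormedAddCommGroup E] [InnerProductSpace ℂ E]
  {K : Type w} [NormedAddCommGroup K] [InnerProductSpace ℂ K] [CompleteSpace K]

/-- The block of multi-degree `m ∈ ℤ^k` of the formal pluriharmonic series with coefficients
`A_{(α;β)} ∈ B(E)`, evaluated at `X`: the (finite) sum of
`A_{(α;β)} ⊗ X_{1,α_1} ⋯ X_{k,α_k} X_{1,β_1}^* ⋯ X_{k,β_k}^*` over `|α_i| = m_i^-`,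
`|β_i| = m_i^+`. Only coefficients for which `α_i` or `β_i` is empty for every `i` ever occur. -/
def block (A : Words n → Words n → (E →L[ℂ] E)) (X : OpTuple n K) (m : Fin k → ℤ) :
    HTensor E K →L[ℂ] HTensor E K :=
  ∑ α : (i : Fin k) → (Fin (-(m i)).toNat → Fin (n i)),
    ∑ β : (i : Fin k) → (Fin (m i).toNat → Fin (n i)),
      opTensor (A (fun i => List.ofFn (α i)) (fun i => List.ofFn (β i)))
        (multiWordOp X (fun i => List.ofFn (α i)) * multiWordOpStar X (fun i => List.ofFn (β i)))

/-- The value `F(X)`, a bounded operator on `E ⊗ K`, of the pluriharmonic series with coefficients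
`A`: the sum over `m ∈ ℤ^k` of the blocks, in the operator norm topology. -/
def evalAt (A : Words n → Words n → (E →L[ℂ] E)) (X : OpTuple n K) :
    HTensor E K →L[ℂ] HTensor E K :=
  ∑' m : Fin k → ℤ, block A X m

/-- `A` is the coefficient family of a free `k`-pluriharmonic function on the abstract polyball:
the multi-series over `m ∈ ℤ^k` converges in the operator norm topology, irrespective of the order
of summation, at every point of `B_n(K)`, for every Hilbert space `K`. -/
def IsFreePluriharmonic (A : Words n → Words n → (E →L[ℂ] E)) : Prop :=
  ∀ (K : Type u) [NormedAddCommGroup K] [InnerProductSpace ℂ K] [CompleteSpace K],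
    ∀ X ∈ openPolyball n K, Summable fun m : Fin k → ℤ => block A X m

/-- The function with coefficients `A` is positive: `F(X) ≥ 0` on the polyball. -/
def IsPositiveOnPolyball (A : Words n → Words n → (E →L[ℂ] E)) : Prop :=
  ∀ (K : Type u) [NormedAddCommGroup K] [InnerProductSpace ℂ K] [CompleteSpace K],
    ∀ X ∈ openPolyball n K, (evalAt A X).IsPositive

end Pluriharmonic

section Poisson

variable (n : Fin k → ℕ)

/-- The tensor product `F²(H_{n_1}) ⊗ ⋯ ⊗ F²(H_{n_k})` of full Fock spaces, realized as the `ℓ²`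
space on `k`-tuples of words: the basis vector at `(α_1, …, α_k)` is `e_{α_1} ⊗ ⋯ ⊗ e_{α_k}`. -/
abbrev FockTensor : Type := lp (fun _ : Words n => ℂ) 2

variable {n}

/-- The orthonormal basis vector `e_{α_1} ⊗ ⋯ ⊗ e_{α_k}`. -/
def fockBasis (α : Words n) : FockTensor n := lp.single 2 α (1 : ℂ)

/-- The `k`-tuple of words obtained from `α` by replacing `α_i` with `α_i g_j`. -/
def appendLetter (i : Fin k) (j : Fin (n i)) (α : Words n) : Words n :=
  Function.update α i (α i ++ [j])

theorem appendLetter_injective (i : Fin k) (j : Fin (n i)) :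
    Function.Injective (appendLetter (n := n) i j) := by
  intro α β h
  funext l
  have hl := congrFun h l
  by_cases hli : l = i
  · subst hli
    simpa [appendLetter] using hl
  · simpa [appendLetter, hli] using hl

theorem orthonormal_fockBasis : Orthonormal ℂ (fockBasis (n := n)) := by
  rw [orthonormal_iff_ite]
  intro α β
  rw [fockBasis, fockBasis, lp.inner_single_left]
  by_cases h : α = β
  · subst h; simp
  · simp [h]

theorem orthonormal_fockBasis_append (i : Fin k) (j : Fin (n i)) :
    Orthonormal ℂ (fun α : Words n => fockBasis (appendLetter i j α)) :=
  orthonormal_fockBasis.comp _ (appendLetter_injective i j)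

/-- The right creation operator `R_{i,j}`, ampliated to the tensor product of the Fock spaces: the
isometry with `e_{α_1} ⊗ ⋯ ⊗ e_{α_k} ↦ e_{α_1} ⊗ ⋯ ⊗ e_{α_i g_j} ⊗ ⋯ ⊗ e_{α_k}`. -/
def rightCreation : OpTuple n (FockTensor n) := fun i j =>
  ((orthonormal_fockBasis_append i j).orthogonalFamily.linearIsometry).toContinuousLinearMap

theorem rightCreation_fockBasis (i : Fin k) (j : Fin (n i)) (α : Words n) :
    rightCreation i j (fockBasis α) = fockBasis (appendLetter i j α) := by
  simp [rightCreation, fockBasis, OrthogonalFamily.linearIsometry_apply_single]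

/-- The coefficients `R_{1,α̃_1}^* ⋯ R_{k,α̃_k}^* R_{1,β̃_1} ⋯ R_{k,β̃_k}` of the Poisson kernel,
where `α̃` is the reverse of the word `α`. -/
def poissonCoeff (α β : Words n) : FockTensor n →L[ℂ] FockTensor n :=
  multiWordOpStar rightCreation (fun i => (α i).reverse) *
    multiWordOp rightCreation (fun i => (β i).reverse)

/-- The free pluriharmonic Poisson kernel `P(R, X)`, an operator on
`F²(H_{n_1}) ⊗ ⋯ ⊗ F²(H_{n_k}) ⊗ K`. -/
def poissonKernel {K : Type w} [NormedAddCommGroup K] [InnerProductSpace ℂ K] [CompleteSpace K]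
    (X : OpTuple n K) : HTensor (FockTensor n) K →L[ℂ] HTensor (FockTensor n) K :=
  evalAt poissonCoeff X

end Poisson

section Equivalence

variable {n : Fin k → ℕ} {H : Type u} [NormedAddCommGroup H] [InnerProductSpace ℂ H]
  [CompleteSpace H]

/-- `A` is Harnack dominated by `B`: for some `c > 0`, `F(rA) ≤ c² F(rB)` for all `r ∈ [0,1)` and
all positive free `k`-pluriharmonic functions `F` with coefficients in `B(E)`, `E` a separable
Hilbert space. -/
def HarnackDominated (A B : OpTuple n H) : Prop :=
  ∃ c : ℝ, 0 < c ∧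
    ∀ (E : Type) [NormedAddCommGroup E] [InnerProductSpace ℂ E] [CompleteSpace E]
      [TopologicalSpace.SeparableSpace E] (C : Words n → Words n → (E →L[ℂ] E)),
      IsFreePluriharmonic.{u} C → IsPositiveOnPolyball.{u} C →
      ∀ r : ℝ, 0 ≤ r → r < 1 →
        evalAt C ((r : ℂ) • A) ≤ ((c : ℂ) ^ 2) • evalAt C ((r : ℂ) • B)

/-- Harnack equivalence. -/
def HarnackEquiv (A B : OpTuple n H) : Prop := HarnackDominated A B ∧ HarnackDominated B A

/-- `A` is Poisson dominated by `B`: for some `c > 0`, `P(R, rA) ≤ c² P(R, rB)` for `r ∈ [0,1)`. -/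
def PoissonDominated (A B : OpTuple n H) : Prop :=
  ∃ c : ℝ, 0 < c ∧ ∀ r : ℝ, 0 ≤ r → r < 1 →
    poissonKernel ((r : ℂ) • A) ≤ ((c : ℂ) ^ 2) • poissonKernel ((r : ℂ) • B)

/-- Poisson equivalence. -/
def PoissonEquiv (A B : OpTuple n H) : Prop := PoissonDominated A B ∧ PoissonDominated B A

variable (n H)

/-- The Harnack part of `B` in the closed polyball. -/
def harnackPart (B : OpTuple n H) : Set (OpTuple n H) :=
  {A | A ∈ closedPolyball n H ∧ HarnackEquiv A B}

/-- The Poisson part of `B` in the closed polyball. -/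
def poissonPart (B : OpTuple n H) : Set (OpTuple n H) :=
  {A | A ∈ closedPolyball n H ∧ PoissonEquiv A B}

end Equivalence

end Polyball

end

/-! Everything rests on the operators `T i = ∑_j R_{i,j} ⊗ X_{i,j}^*` (`poissonRow`).
Cross-commutation of `X` makes them commute, each block of the Poisson kernel `P` is a monomial in
the `T i` and their adjoints (`block_poissonCoeff`), and `R_{i,a}^* R_{i,b} = δ_{ab}` gives `T i^*
(I ⊗ Y) T i = I ⊗ Φ_i(Y)`. When all `‖T i‖ < 1`, summing geometric series one variable at a time
yields `B^* P B = I ⊗ Δ_X(I)` with `B = ∏ (1 - T i)` (`conj_poissonKernel`). Hence `P` is positive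
on the open polyball, and Harnack domination specializes to Poisson domination.

If `A` is Poisson equivalent to `0`, then `P(R, rA)` lies between two positive constants, uniformly
in `r`. The upper bound, tested on `e_∅ ⊗ h`, controls `∑_p ‖T i^p (e_∅ ⊗ h)‖²` because the terms
are orthogonal components. For a contraction these norms decrease, so `‖Φ_i^N(I)‖ = O(1/N)` and the
spectral radius is below 1 (`exists_norm_poissonRow_pow_lt_one`).

Spectral radius below 1 makes `B` invertible at `A` itself, so the lower bound on `P` passes through
the factorization to the limit `r → 1` and gives `Δ_A(I) ≥ εI` for some `ε > 0`. Telescoping removes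
the factors `1 - Φ_j` and leaves `I - Φ_i(I) ≥ εI`, the strict row bound
(`mem_openPolyball_of_le_poissonKernel`).

Conversely, for `A` in the open polyball some `sA` with `s > 1` is still there. Rotating each `A_i`
by a phase preserves the polyball, so a positive `F` is nonnegative on a torus through `sA`, and the
classical Harnack inequality for the product Poisson kernel, with radius `r/s`, compares `F(rA)`
with `F(0)` (`evalAt_harnack`). -/

noncomputable section

namespace Polyball

universe u

/-! ### Operators on the Hilbert tensor product and the ampliation `Y ↦ I ⊗ Y`. -/

section TensorAlgebra

variable {E : Type*} [NormedAddCommGroup E] [InnerProductSpace ℂ E]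
  {K : Type*} [NormedAddCommGroup K] [InnerProductSpace ℂ K]

theorem hTensor_ext {F : Type*} [NormedAddCommGroup F] [NormedSpace ℂ F]
    {S T : HTensor E K →L[ℂ] F}
    (h : ∀ (x : E) (y : K), S ((x ⊗ₜ[ℂ] y : E ⊗[ℂ] K) : HTensor E K) =
      T ((x ⊗ₜ[ℂ] y : E ⊗[ℂ] K) : HTensor E K)) : S = T := by
  ext z
  induction z using UniformSpace.Completion.induction_on with
  | hp => exact isClosed_eq S.continuous T.continuous
  | ih z =>
    induction z using TensorProduct.induction_on with
    | zero => rw [UniformSpace.Completion.coe_zero, map_zero, map_zero]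
    | tmul x y => exact h x y
    | add a b ha hb => simp [UniformSpace.Completion.coe_add, ha, hb]

theorem opTensor_mul (S S' : E →L[ℂ] E) (T T' : K →L[ℂ] K) :
    opTensor (S * S') (T * T') = opTensor S T * opTensor S' T' :=
  hTensor_ext fun x y => by simp [opTensor_coe_tmul]

theorem opTensor_one : opTensor (1 : E →L[ℂ] E) (1 : K →L[ℂ] K) = 1 :=
  hTensor_ext fun x y => by simp [opTensor_coe_tmul]

theorem opTensor_add_right (S : E →L[ℂ] E) (T T' : K →L[ℂ] K) :
    opTensor S (T + T') = opTensor S T + opTensor S T' :=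
  hTensor_ext fun x y => by
    simp [opTensor_coe_tmul, TensorProduct.tmul_add, UniformSpace.Completion.coe_add]

theorem opTensor_smul_right (c : ℂ) (S : E →L[ℂ] E) (T : K →L[ℂ] K) :
    opTensor S (c • T) = c • opTensor S T :=
  hTensor_ext fun x y => by
    simp [opTensor_coe_tmul, TensorProduct.tmul_smul, UniformSpace.Completion.coe_smul]

theorem opTensor_zero_right (S : E →L[ℂ] E) : opTensor S (0 : K →L[ℂ] K) = 0 :=
  hTensor_ext fun x y => by simp [opTensor_coe_tmul]

theorem opTensor_zero_left (T : K →L[ℂ] K) : opTensor (0 : E →L[ℂ] E) T = 0 :=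
  hTensor_ext fun x y => by simp [opTensor_coe_tmul]

theorem opTensor_list_prod {ι : Type*} (l : List ι) (S : ι → E →L[ℂ] E) (T : ι → K →L[ℂ] K) :
    opTensor (l.map S).prod (l.map T).prod = (l.map fun i => opTensor (S i) (T i)).prod := by
  induction l with
  | nil => simp [opTensor_one]
  | cons a l ih => simp [opTensor_mul, ih]

theorem hTensor_star_mul (A B : HTensor E K →L[ℂ] HTensor E K) :
    star (A * B) = star B * star A :=
  star_mul (R := HTensor E K →L[ℂ] HTensor E K) A B

theorem hTensor_star_one : star (1 : HTensor E K →L[ℂ] HTensor E K) = 1 :=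
  star_one (HTensor E K →L[ℂ] HTensor E K)

theorem hTensor_star_star (A : HTensor E K →L[ℂ] HTensor E K) : star (star A) = A :=
  star_star (R := HTensor E K →L[ℂ] HTensor E K) A

theorem hTensor_star_sum {ι : Type*} (s : Finset ι) (A : ι → HTensor E K →L[ℂ] HTensor E K) :
    star (∑ i ∈ s, A i) = ∑ i ∈ s, star (A i) :=
  star_sum (R := HTensor E K →L[ℂ] HTensor E K) s A

theorem hTensor_star_pow (A : HTensor E K →L[ℂ] HTensor E K) (p : ℕ) :
    star (A ^ p) = star A ^ p :=
  star_pow (R := HTensor E K →L[ℂ] HTensor E K) A p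

variable [CompleteSpace E] [CompleteSpace K]

theorem star_opTensor (S : E →L[ℂ] E) (T : K →L[ℂ] K) :
    star (opTensor S T) = opTensor (star S) (star T) := by
  symm
  refine (ContinuousLinearMap.eq_adjoint_iff _ _).2 fun z w => ?_
  induction z, w using UniformSpace.Completion.induction_on₂ with
  | hp => exact isClosed_eq (by fun_prop) (by fun_prop)
  | ih z w =>
    induction z using TensorProduct.induction_on with
    | zero => simp only [UniformSpace.Completion.coe_zero, map_zero, inner_zero_left]
    | add a b ha hb => simp [UniformSpace.Completion.coe_add, inner_add_left, ha, hb]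
    | tmul x y =>
      induction w using TensorProduct.induction_on with
      | zero => simp only [UniformSpace.Completion.coe_zero, map_zero, inner_zero_right]
      | add a b ha hb =>
        simp only [UniformSpace.Completion.coe_add, inner_add_right, map_add, ha, hb]
      | tmul x' y' =>
        simp [opTensor_coe_tmul, UniformSpace.Completion.inner_coe, TensorProduct.inner_tmul,
          ContinuousLinearMap.star_eq_adjoint, ContinuousLinearMap.adjoint_inner_left]

variable (E K) in
/-- The `*`-homomorphism `Y ↦ I ⊗ Y`. -/
def ampliation : (K →L[ℂ] K) →⋆ₐ[ℂ] (HTensor E K →L[ℂ] HTensor E K) where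
  toFun Y := opTensor 1 Y
  map_one' := opTensor_one
  map_mul' Y Z := by rw [← opTensor_mul, one_mul]
  map_zero' := opTensor_zero_right _
  map_add' Y Z := opTensor_add_right _ _ _
  commutes' c := by
    rw [Algebra.algebraMap_eq_smul_one, Algebra.algebraMap_eq_smul_one, opTensor_smul_right,
      opTensor_one]
  map_star' Y := by rw [star_opTensor, star_one]

theorem ampliation_apply (Y : K →L[ℂ] K) : ampliation E K Y = opTensor 1 Y := rfl

theorem inner_ampliation_tmul (Y : K →L[ℂ] K) (x x' : E) (y y' : K) :
    inner ℂ (ampliation E K Y ((x ⊗ₜ[ℂ] y : E ⊗[ℂ] K) : HTensor E K))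
      ((x' ⊗ₜ[ℂ] y' : E ⊗[ℂ] K) : HTensor E K) = inner ℂ x x' * inner ℂ (Y y) y' := by
  simp [ampliation_apply, opTensor_coe_tmul, UniformSpace.Completion.inner_coe,
    TensorProduct.inner_tmul]

theorem ampliation_injective [Nontrivial E] : Function.Injective (ampliation E K) := by
  obtain ⟨e, he⟩ := exists_ne (0 : E)
  rw [injective_iff_map_eq_zero]
  intro Y hY
  ext y
  have := inner_ampliation_tmul Y e e y (Y y)
  rw [hY] at this
  simpa [he] using this

theorem norm_ampliation [Nontrivial E] (Y : K →L[ℂ] K) : ‖ampliation E K Y‖ = ‖Y‖ :=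
  NonUnitalStarAlgHom.norm_map _ ampliation_injective Y

omit [CompleteSpace K] in
open scoped ComplexOrder in
theorem nonneg_iff_inner_nonneg {Y : K →L[ℂ] K} : 0 ≤ Y ↔ ∀ x, 0 ≤ inner ℂ (Y x) x := by
  rw [ContinuousLinearMap.nonneg_iff_isPositive]
  refine ⟨fun h x => h.inner_nonneg_left x, fun h => ?_⟩
  refine (ContinuousLinearMap.isPositive_iff_complex Y).2 fun x => ?_
  have := Complex.nonneg_iff.1 (h x)
  exact ⟨Complex.ext rfl this.2, this.1⟩

-- Testing on `e ⊗ y` with a fixed `e ≠ 0` gives `‖e‖² ⟪Y y, y⟫`. This brings operator inequalities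
-- obtained on the Fock side back to `K`.
open scoped ComplexOrder in
theorem ampliation_nonneg_iff [Nontrivial E] {Y : K →L[ℂ] K} : 0 ≤ ampliation E K Y ↔ 0 ≤ Y := by
  refine ⟨fun h => nonneg_iff_inner_nonneg.2 fun y => ?_, map_nonneg _⟩
  obtain ⟨e, he⟩ := exists_ne (0 : E)
  have := nonneg_iff_inner_nonneg.1 h ((e ⊗ₜ[ℂ] y : E ⊗[ℂ] K) : HTensor E K)
  rw [inner_ampliation_tmul] at this
  have hpos : 0 < ‖e‖ ^ 2 := pow_pos (norm_pos_iff.2 he) 2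
  have hee : inner ℂ e e = ((‖e‖ ^ 2 : ℝ) : ℂ) := by simp [inner_self_eq_norm_sq_to_K]
  rw [hee] at this
  generalize ‖e‖ ^ 2 = t at hpos this
  rw [Complex.nonneg_iff] at this ⊢
  simpa [hpos.ne', mul_nonneg_iff_of_pos_left hpos, eq_comm (a := (0 : ℝ))] using this

theorem ampliation_le_iff [Nontrivial E] {Y Z : K →L[ℂ] K} :
    ampliation E K Y ≤ ampliation E K Z ↔ Y ≤ Z := by
  rw [← sub_nonneg, ← map_sub, ampliation_nonneg_iff, sub_nonneg]

end TensorAlgebra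

/-! ### Scalar Harnack inequality on the torus. -/

section TorusHarnack

open MeasureTheory

theorem summable_fin_prod {k : ℕ} {ι : Type*} (f : Fin k → ι → ℝ) (hf : ∀ i m, 0 ≤ f i m)
    (hs : ∀ i, Summable (f i)) : Summable fun m : Fin k → ι => ∏ i, f i (m i) := by
  induction k with
  | zero => exact Summable.of_finite
  | succ k ih =>
    rw [← (Fin.consEquiv fun _ : Fin (k + 1) => ι).summable_iff]
    have h := (hs 0).mul_of_nonneg (ih (fun i => f i.succ) (fun i => hf _) fun i => hs _) (hf 0)
      (fun m => Finset.prod_nonneg fun i _ => hf _ _)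
    refine h.congr fun x => ?_
    simp [Fin.prod_univ_succ, Fin.consEquiv]

theorem summable_pow_natAbs {ρ : ℝ} (h0 : 0 ≤ ρ) (h1 : ρ < 1) :
    Summable fun m : ℤ => ρ ^ m.natAbs := by
  refine Summable.of_nat_of_neg ?_ ?_ <;>
    simpa using summable_geometric_of_lt_one h0 h1

theorem summable_prod_pow_natAbs {k : ℕ} {ρ : Fin k → ℝ} (h0 : ∀ i, 0 ≤ ρ i) (h1 : ∀ i, ρ i < 1) :
    Summable fun m : Fin k → ℤ => ∏ i, ρ i ^ (m i).natAbs :=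
  summable_fin_prod (fun i (m : ℤ) => ρ i ^ m.natAbs) (fun i _ => pow_nonneg (h0 i) _)
    fun i => summable_pow_natAbs (h0 i) (h1 i)

theorem norm_fourier_apply (m : ℤ) (x : UnitAddCircle) : ‖(fourier m x : ℂ)‖ = 1 := by
  rw [fourier_apply]
  exact Circle.norm_coe _

/-- The Poisson kernel of the unit disc, as a function on `ℝ / ℤ`. -/
def discPoisson (ρ : ℝ) (x : UnitAddCircle) : ℝ :=
  (1 - ρ ^ 2) / Complex.normSq (1 - ρ * fourier 1 x)

variable {ρ : ℝ}

theorem normSq_one_sub_mul_fourier_bounds (h0 : 0 ≤ ρ) (h1 : ρ < 1) (x : UnitAddCircle) :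
    (1 - ρ) ^ 2 ≤ Complex.normSq (1 - ρ * fourier 1 x) ∧
      Complex.normSq (1 - ρ * fourier 1 x) ≤ (1 + ρ) ^ 2 := by
  have hn : ‖(ρ : ℂ) * fourier 1 x‖ = ρ := by
    simp [-fourier_apply, norm_fourier_apply, abs_of_nonneg h0]
  rw [Complex.normSq_eq_norm_sq]
  constructor
  · refine pow_le_pow_left₀ (by linarith) ?_ 2
    have := norm_sub_norm_le (1 : ℂ) (ρ * fourier 1 x)
    rwa [norm_one, hn] at this
  · refine pow_le_pow_left₀ (norm_nonneg _) ?_ 2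
    have := norm_sub_le (1 : ℂ) (ρ * fourier 1 x)
    rwa [norm_one, hn] at this

/-- Write `1 - ρ² = (1 - ρ)(1 + ρ)` and use `1 - ρ ≤ |1 - ρ e^{iθ}| ≤ 1 + ρ`. -/
theorem discPoisson_bounds (h0 : 0 ≤ ρ) (h1 : ρ < 1) (x : UnitAddCircle) :
    ((1 + ρ) / (1 - ρ))⁻¹ ≤ discPoisson ρ x ∧ discPoisson ρ x ≤ (1 + ρ) / (1 - ρ) := by
  obtain ⟨hl, hu⟩ := normSq_one_sub_mul_fourier_bounds h0 h1 x
  have hp : 0 < 1 - ρ := by linarith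
  have hq : 0 < 1 + ρ := by linarith
  have hpos := lt_of_lt_of_le (pow_pos hp 2) hl
  rw [discPoisson, inv_div]
  constructor
  · rw [div_le_div_iff₀ hq hpos]
    nlinarith [mul_le_mul_of_nonneg_left hu hp.le]
  · rw [div_le_div_iff₀ hpos hp]
    nlinarith [mul_le_mul_of_nonneg_left hl hq.le]

theorem continuous_discPoisson (h0 : 0 ≤ ρ) (h1 : ρ < 1) : Continuous (discPoisson ρ) := by
  unfold discPoisson
  refine continuous_const.div (Complex.continuous_normSq.comp (by fun_prop)) fun x => ?_
  have := (normSq_one_sub_mul_fourier_bounds h0 h1 x).1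
  have h2 : 0 < (1 - ρ) ^ 2 := pow_pos (by linarith) 2
  linarith

/-- Splits the kernel into its frequencies `≥ 0` and `< 0`, each the sum of a geometric series. -/
theorem discPoisson_eq (h0 : 0 ≤ ρ) (h1 : ρ < 1) (x : UnitAddCircle) :
    (discPoisson ρ x : ℂ) = (1 - (ρ : ℂ) * fourier 1 x)⁻¹ +
      (starRingEnd ℂ) ((ρ : ℂ) * fourier 1 x) *
        (1 - (starRingEnd ℂ) ((ρ : ℂ) * fourier 1 x))⁻¹ := by
  rw [discPoisson]
  have hn : ‖(ρ : ℂ) * fourier 1 x‖ = ρ := by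
    simp [-fourier_apply, norm_fourier_apply, abs_of_nonneg h0]
  generalize (ρ : ℂ) * fourier 1 x = z at hn ⊢
  have hz1 : (1 : ℂ) - z ≠ 0 := fun h => by
    rw [← sub_eq_zero.1 h, norm_one] at hn
    exact h1.ne hn.symm
  have hz2 : (1 : ℂ) - (starRingEnd ℂ) z ≠ 0 := fun h => hz1 (by
    simpa using congrArg (starRingEnd ℂ) h)
  have h3 : (Complex.normSq (1 - z) : ℂ) = (1 - z) * (1 - (starRingEnd ℂ) z) := by
    rw [← Complex.mul_conj, map_sub, map_one]
  have h4 : z * (starRingEnd ℂ) z = (ρ : ℂ) ^ 2 := by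
    rw [Complex.mul_conj, Complex.normSq_eq_norm_sq, hn, Complex.ofReal_pow]
  rw [Complex.ofReal_div, h3, Complex.ofReal_sub, Complex.ofReal_pow, ← h4, Complex.ofReal_one]
  field_simp
  ring

theorem fourier_natCast_apply (j : ℕ) (x : UnitAddCircle) :
    (fourier (j : ℤ) x : ℂ) = (fourier 1 x : ℂ) ^ j := by
  rw [fourier_apply, fourier_apply, one_zsmul, natCast_zsmul]
  exact congrArg Subtype.val (AddCircle.toCircle_nsmul x j)

theorem hasSum_discPoisson (h0 : 0 ≤ ρ) (h1 : ρ < 1) (x : UnitAddCircle) :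
    HasSum (fun m : ℤ => (ρ : ℂ) ^ m.natAbs * fourier m x) (discPoisson ρ x : ℂ) := by
  have hn : ‖(ρ : ℂ) * fourier 1 x‖ < 1 := by
    simpa [-fourier_apply, norm_fourier_apply, abs_of_nonneg h0] using h1
  have hn' : ‖(starRingEnd ℂ) ((ρ : ℂ) * fourier 1 x)‖ < 1 := by rwa [Complex.norm_conj]
  rw [discPoisson_eq h0 h1]
  refine HasSum.of_nat_of_neg_add_one ?_ ?_
  · refine (hasSum_geometric_of_norm_lt_one hn).congr_fun fun j => ?_
    rw [fourier_natCast_apply, mul_pow, Int.natAbs_natCast]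
  · refine ((hasSum_geometric_of_norm_lt_one hn').mul_left _).congr_fun fun j => ?_
    have h5 : (-((j : ℤ) + 1)).natAbs = j + 1 := by omega
    rw [h5, fourier_neg, ← Nat.cast_succ, fourier_natCast_apply, ← pow_succ', map_pow, map_mul,
      mul_pow, Complex.conj_ofReal]

theorem integral_fourier (m : ℤ) :
    ∫ x : UnitAddCircle, (fourier m x : ℂ) ∂AddCircle.haarAddCircle = if m = 0 then 1 else 0 := by
  have h := congrFun (fourierCoeff_fourier (T := 1) m) 0
  simpa [fourierCoeff, Pi.single_apply, eq_comm] using h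

theorem integral_fourier_mul_discPoisson (h0 : 0 ≤ ρ) (h1 : ρ < 1) (m : ℤ) :
    ∫ x : UnitAddCircle, (fourier m x : ℂ) * (discPoisson ρ x : ℂ) ∂AddCircle.haarAddCircle =
      (ρ : ℂ) ^ m.natAbs := by
  have hs := hasSum_integral_of_summable_integral_norm (μ := AddCircle.haarAddCircle)
    (F := fun (l : ℤ) (x : UnitAddCircle) =>
      (fourier m x : ℂ) * ((ρ : ℂ) ^ l.natAbs * fourier l x)) (fun l => ?_) ?_
  · have h2 : ∀ x : UnitAddCircle, ∑' l : ℤ, (fourier m x : ℂ) *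
        ((ρ : ℂ) ^ l.natAbs * fourier l x) = (fourier m x : ℂ) * (discPoisson ρ x : ℂ) :=
      fun x => ((hasSum_discPoisson h0 h1 x).mul_left _).tsum_eq
    simp only [h2] at hs
    rw [← hs.tsum_eq, tsum_eq_single (-m)]
    · have : ∀ x : UnitAddCircle, (fourier m x : ℂ) * ((ρ : ℂ) ^ (-m).natAbs * fourier (-m) x) =
          (ρ : ℂ) ^ m.natAbs * fourier 0 x := fun x => by
        rw [mul_left_comm, ← fourier_add, add_neg_cancel, Int.natAbs_neg]
      simp only [this]
      rw [integral_const_mul, integral_fourier]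
      simp
    · intro l hl
      have : ∀ x : UnitAddCircle, (fourier m x : ℂ) * ((ρ : ℂ) ^ l.natAbs * fourier l x) =
          (ρ : ℂ) ^ l.natAbs * fourier (m + l) x := fun x => by
        rw [mul_left_comm, ← fourier_add]
      simp only [this]
      rw [integral_const_mul, integral_fourier, if_neg (fun h => hl (by omega)), mul_zero]
  · exact (by fun_prop : Continuous _).integrable_of_hasCompactSupport
      (HasCompactSupport.of_compactSpace _)
  · refine (summable_pow_natAbs h0 h1).congr fun l => ?_
    simp [-fourier_apply, norm_fourier_apply, abs_of_nonneg h0]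

/-- **Harnack inequality on the torus**: if an absolutely convergent multiple Fourier series has
nonnegative real part, its Poisson integral is comparable with its mean. -/
theorem torus_harnack {k : ℕ} (h0 : 0 ≤ ρ) (h1 : ρ < 1) (c : (Fin k → ℤ) → ℂ)
    (hc : Summable fun m => ‖c m‖)
    (hpos : ∀ θ : Fin k → UnitAddCircle, 0 ≤ (∑' m, c m * ∏ i, fourier (m i) (θ i)).re) :
    0 ≤ (c 0).re ∧
      (((1 + ρ) / (1 - ρ)) ^ k)⁻¹ * (c 0).re ≤ (∑' m, (∏ i, (ρ : ℂ) ^ (m i).natAbs) * c m).re ∧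
      (∑' m, (∏ i, (ρ : ℂ) ^ (m i).natAbs) * c m).re ≤ ((1 + ρ) / (1 - ρ)) ^ k * (c 0).re := by
  set μ : Measure (Fin k → UnitAddCircle) := Measure.pi fun _ => AddCircle.haarAddCircle with hμ
  set g : (Fin k → UnitAddCircle) → ℂ := fun θ => ∑' m, c m * ∏ i, fourier (m i) (θ i) with hg
  have hnorm : ∀ (m : Fin k → ℤ) (θ : Fin k → UnitAddCircle),
      ‖∏ i, (fourier (m i) (θ i) : ℂ)‖ = 1 := fun m θ => by
    simp [-fourier_apply, norm_fourier_apply]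
  have hgc : Continuous g := by
    refine continuous_tsum (fun m => by fun_prop) hc fun m θ => ?_
    rw [norm_mul, hnorm, mul_one]
  -- Integration against a product weight is used twice: `w = 1` extracts the mean `c 0`, and `w =
  -- discPoisson ρ` produces the Poisson integral.
  have key : ∀ w : UnitAddCircle → ℝ, Continuous w →
      ∫ θ, (g θ).re * ∏ i, w (θ i) ∂μ =
        (∑' m, c m * ∏ i, ∫ x, (fourier (m i) x : ℂ) * (w x : ℂ) ∂AddCircle.haarAddCircle).re := by
    intro w hw
    have hs := hasSum_integral_of_summable_integral_norm (μ := μ)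
      (F := fun (m : Fin k → ℤ) (θ : Fin k → UnitAddCircle) =>
        c m * ∏ i, ((fourier (m i) (θ i) : ℂ) * (w (θ i) : ℂ))) (fun m => ?_) ?_
    · have h2 : ∀ θ : Fin k → UnitAddCircle,
          ∑' m : Fin k → ℤ, c m * ∏ i, ((fourier (m i) (θ i) : ℂ) * (w (θ i) : ℂ)) =
            g θ * ((∏ i, w (θ i) : ℝ) : ℂ) := fun θ => by
        rw [hg, ← tsum_mul_right]
        refine tsum_congr fun m => ?_
        rw [Finset.prod_mul_distrib]
        push_cast
        ring
      simp only [h2, integral_const_mul] at hs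
      have h3 : ∀ m : Fin k → ℤ, ∫ θ, ∏ i, ((fourier (m i) (θ i) : ℂ) * (w (θ i) : ℂ)) ∂μ =
          ∏ i, ∫ x, (fourier (m i) x : ℂ) * (w x : ℂ) ∂AddCircle.haarAddCircle := fun m =>
        integral_fintype_prod_eq_prod (fun i x => (fourier (m i) x : ℂ) * (w x : ℂ))
      simp only [h3] at hs
      rw [hs.tsum_eq]
      have hint : Integrable (fun θ => g θ * ((∏ i, w (θ i) : ℝ) : ℂ)) μ :=
        (by fun_prop : Continuous _).integrable_of_hasCompactSupport
          (HasCompactSupport.of_compactSpace _)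
      have := integral_re hint
      simp only [RCLike.re_to_complex] at this
      rw [← this]
      refine integral_congr_ae (Filter.Eventually.of_forall fun θ => ?_)
      exact (Complex.re_mul_ofReal _ _).symm
    · exact (by fun_prop : Continuous _).integrable_of_hasCompactSupport
        (HasCompactSupport.of_compactSpace _)
    · refine (hc.mul_right (∫ θ, ∏ i, |w (θ i)| ∂μ)).congr fun m => ?_
      rw [← integral_const_mul]
      refine integral_congr_ae (Filter.Eventually.of_forall fun θ => ?_)
      simp [-fourier_apply, norm_fourier_apply]
  have hmean : ∫ θ, (g θ).re ∂μ = (c 0).re := by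
    have := key (fun _ => 1) continuous_const
    simp only [Finset.prod_const_one, mul_one, Complex.ofReal_one, integral_fourier] at this
    rw [this, tsum_eq_single 0]
    · simp
    · intro m hm
      obtain ⟨i, hi⟩ := Function.ne_iff.1 hm
      rw [Finset.prod_eq_zero (Finset.mem_univ i) (if_neg hi), mul_zero]
  have hpois := key _ (continuous_discPoisson h0 h1)
  simp only [integral_fourier_mul_discPoisson h0 h1] at hpois
  simp only [mul_comm (∏ i, (ρ : ℂ) ^ _) (c _)]
  rw [← hpois, ← hmean, ← integral_const_mul, ← integral_const_mul]
  have hq : 0 ≤ ((1 + ρ) / (1 - ρ))⁻¹ := inv_nonneg.2 (div_nonneg (by linarith) (by linarith))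
  have hcard : ∀ a : ℝ, a ^ k = ∏ _i : Fin k, a := fun a => by simp
  have hgr : Continuous fun θ => (g θ).re := Complex.continuous_re.comp hgc
  have hpc := continuous_discPoisson h0 h1
  have hi1 : Integrable (fun θ => (g θ).re * ∏ i, discPoisson ρ (θ i)) μ :=
    (by fun_prop : Continuous _).integrable_of_hasCompactSupport
      (HasCompactSupport.of_compactSpace _)
  have hi2 : ∀ a : ℝ, Integrable (fun θ => a * (g θ).re) μ := fun a =>
    (by fun_prop : Continuous _).integrable_of_hasCompactSupport
      (HasCompactSupport.of_compactSpace _)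
  refine ⟨integral_nonneg fun θ => hpos θ, ?_, ?_⟩
  · refine integral_mono (hi2 _) hi1 fun θ => ?_
    dsimp only
    rw [mul_comm, ← inv_pow, hcard]
    exact mul_le_mul_of_nonneg_left (Finset.prod_le_prod (fun i _ => hq)
      fun i _ => (discPoisson_bounds h0 h1 _).1) (hpos θ)
  · refine integral_mono hi1 (hi2 _) fun θ => ?_
    dsimp only
    rw [mul_comm _ (g θ).re, hcard]
    exact mul_le_mul_of_nonneg_left (Finset.prod_le_prod
      (fun i _ => hq.trans (discPoisson_bounds h0 h1 _).1)
      fun i _ => (discPoisson_bounds h0 h1 _).2) (hpos θ)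

open scoped ComplexOrder in
theorem torus_harnack_complex {k : ℕ} (h0 : 0 ≤ ρ) (h1 : ρ < 1) (c : (Fin k → ℤ) → ℂ)
    (hc : Summable fun m => ‖c m‖)
    (hpos : ∀ θ : Fin k → UnitAddCircle, 0 ≤ ∑' m, c m * ∏ i, fourier (m i) (θ i)) :
    0 ≤ c 0 ∧
      (((((1 + ρ) / (1 - ρ)) ^ k)⁻¹ : ℝ) : ℂ) * c 0 ≤ ∑' m, (∏ i, (ρ : ℂ) ^ (m i).natAbs) * c m ∧
      ∑' m, (∏ i, (ρ : ℂ) ^ (m i).natAbs) * c m ≤ (((((1 + ρ) / (1 - ρ)) ^ k : ℝ)) : ℂ) * c 0 := by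
  -- For imaginary `w` the series multiplied by `w` has real part identically zero, so the real
  -- inequality applies to it; `w = ±I` then forces both imaginary parts to vanish.
  have him : ∀ w : ℂ, w.re = 0 → 0 ≤ (w * c 0).re ∧
      0 ≤ (w * ∑' m, (∏ i, (ρ : ℂ) ^ (m i).natAbs) * c m).re := by
    intro w hw
    have h := torus_harnack h0 h1 (fun m => w * c m) (by simpa using hc.mul_left ‖w‖) fun θ => by
      simp only [mul_assoc]
      rw [tsum_mul_left, Complex.mul_re, hw, ← (Complex.nonneg_iff.1 (hpos θ)).2]
      simp
    simp only [mul_left_comm _ w] at h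
    rw [tsum_mul_left] at h
    exact ⟨h.1, le_trans (mul_nonneg (inv_nonneg.2 (pow_nonneg
      (div_nonneg (by linarith) (by linarith)) _)) h.1) h.2.1⟩
  have hi1 := him Complex.I Complex.I_re
  have hi2 := him (-Complex.I) (by simp)
  simp only [Complex.mul_re, Complex.I_re, Complex.I_im, Complex.neg_re, zero_mul, one_mul, zero_sub,
    neg_mul, neg_neg] at hi1 hi2
  have e1 : (c 0).im = 0 := by linarith [hi1.1, hi2.1]
  have e2 : (∑' m, (∏ i, (ρ : ℂ) ^ (m i).natAbs) * c m).im = 0 := by linarith [hi1.2, hi2.2]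
  obtain ⟨h2, h3, h4⟩ := torus_harnack h0 h1 c hc fun θ => (Complex.nonneg_iff.1 (hpos θ)).1
  refine ⟨Complex.nonneg_iff.2 ⟨h2, e1.symm⟩, Complex.le_def.2 ⟨?_, ?_⟩, Complex.le_def.2 ⟨?_, ?_⟩⟩
  · rwa [Complex.re_ofReal_mul]
  · rw [Complex.im_ofReal_mul, e1, e2, mul_zero]
  · rwa [Complex.re_ofReal_mul]
  · rw [Complex.im_ofReal_mul, e1, e2, mul_zero]

end TorusHarnack

/-! ### Poisson kernel of commuting strict contractions in a C*-algebra. -/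

section AbstractPoisson

variable {𝒜 : Type*} [CStarAlgebra 𝒜]

/-- The map `Y ↦ T^* Y T`. -/
def conjMap (T : 𝒜) : Module.End ℂ 𝒜 := LinearMap.mulLeft ℂ (star T) ∘ₗ LinearMap.mulRight ℂ T

theorem conjMap_apply (T Y : 𝒜) : conjMap T Y = star T * Y * T := by
  simp [conjMap, mul_assoc]

/-- The term of multi-degree `m` of the Poisson kernel of a tuple of commuting elements. -/
def poissonTerm {k : ℕ} (T : Fin k → 𝒜) (m : Fin k → ℤ) : 𝒜 :=
  (List.ofFn fun i => star (T i) ^ (-(m i)).toNat).prod *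
    (List.ofFn fun i => T i ^ (m i).toNat).prod

/-- Only `T 0 ^ a.toNat` has to move past the other unstarred powers. The nested form lets an
induction on `k` sum one variable at a time. -/
theorem poissonTerm_cons {k : ℕ} (T : Fin (k + 1) → 𝒜) (hT : ∀ i j, Commute (T i) (T j))
    (a : ℤ) (m : Fin k → ℤ) :
    poissonTerm T (Fin.cons a m) =
      star (T 0) ^ (-a).toNat * poissonTerm (fun i => T i.succ) m * T 0 ^ a.toNat := by
  have hc : Commute (T 0 ^ a.toNat) (List.ofFn fun i : Fin k => T i.succ ^ (m i).toNat).prod := by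
    refine Commute.list_prod_right _ _ fun y hy => ?_
    obtain ⟨i, rfl⟩ := (List.mem_ofFn' _ _).1 hy
    exact (hT 0 i.succ).pow_pow _ _
  simp only [poissonTerm, List.ofFn_succ, List.prod_cons, Fin.cons_zero, Fin.cons_succ]
  rw [hc.eq]
  simp only [mul_assoc]

theorem norm_poissonTerm_le [NormOneClass 𝒜] {k : ℕ} (T : Fin k → 𝒜)
    (hT : ∀ i j, Commute (T i) (T j)) (m : Fin k → ℤ) :
    ‖poissonTerm T m‖ ≤ ∏ i, ‖T i‖ ^ (m i).natAbs := by
  induction k with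
  | zero => simp [poissonTerm]
  | succ k ih =>
    obtain ⟨a, m, rfl⟩ : ∃ a m', m = Fin.cons a m' := ⟨m 0, Fin.tail m, (Fin.cons_self_tail m).symm⟩
    rw [poissonTerm_cons T hT, Fin.prod_univ_succ]
    have h1 := ih (fun i => T i.succ) (fun i j => hT _ _) m
    have h2 : ‖star (T 0) ^ (-a).toNat‖ ≤ ‖T 0‖ ^ (-a).toNat := by
      simpa using norm_pow_le (star (T 0)) (-a).toNat
    have h3 := norm_pow_le (T 0) a.toNat
    have h4 : a.natAbs = (-a).toNat + a.toNat := by omega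
    calc _ ≤ ‖star (T 0) ^ (-a).toNat‖ * ‖poissonTerm (fun i => T i.succ) m‖ * ‖T 0 ^ a.toNat‖ :=
          norm_mul₃_le
      _ ≤ ‖T 0‖ ^ (-a).toNat * (∏ i, ‖T i.succ‖ ^ (m i).natAbs) * ‖T 0‖ ^ a.toNat := by gcongr
      _ = _ := by
          simp only [Fin.cons_zero, Fin.cons_succ]
          rw [h4, pow_add]; ring

theorem summable_norm_poissonTerm {k : ℕ} (T : Fin k → 𝒜) (hT : ∀ i j, Commute (T i) (T j))
    (h1 : ∀ i, ‖T i‖ < 1) : Summable fun m => ‖poissonTerm T m‖ := by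
  nontriviality 𝒜
  exact (summable_prod_pow_natAbs (fun i => norm_nonneg (T i)) h1).of_nonneg_of_le
    (fun m => norm_nonneg _) fun m => norm_poissonTerm_le T hT m

/-- The sum is `Q = Y (1 - T)⁻¹ + T^* (1 - T^*)⁻¹ Y`, so conjugation gives `(1 - T^*) Y + T^* Y (1 -
T)`. No relation between `T` and `Y` enters, which allows `Y` to be the kernel of the remaining
variables. -/
theorem exists_hasSum_conj (T Y : 𝒜) (h1 : ‖T‖ < 1) :
    ∃ Q, HasSum (fun m : ℤ => star T ^ (-m).toNat * Y * T ^ m.toNat) Q ∧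
      star (1 - T) * Q * (1 - T) = Y - star T * Y * T := by
  have h1' : ‖star T‖ < 1 := by rwa [norm_star]
  have hs := (summable_geometric_of_norm_lt_one h1).hasSum
  have hs' := (summable_geometric_of_norm_lt_one h1').hasSum
  refine ⟨Y * (∑' j : ℕ, T ^ j) + star T * (∑' j : ℕ, star T ^ j) * Y,
    HasSum.of_nat_of_neg_add_one ?_ ?_, ?_⟩
  · refine (hs.mul_left Y).congr_fun fun j => ?_
    simp
  · refine ((hs'.mul_left (star T)).mul_right Y).congr_fun fun j => ?_
    have h5 : (- -((j : ℤ) + 1)).toNat = j + 1 := by omega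
    have h6 : (-((j : ℤ) + 1)).toNat = 0 := by omega
    rw [h5, h6, pow_zero, mul_one, pow_succ']
  · have e1 := geom_series_mul_neg T h1
    have e2 := mul_neg_geom_series (star T) h1'
    rw [star_sub, star_one, mul_add, add_mul]
    have e3 : (1 - star T) * (Y * ∑' j : ℕ, T ^ j) * (1 - T) = (1 - star T) * Y := by
      rw [mul_assoc, mul_assoc, e1, mul_one]
    have e4 : (1 - star T) * (star T * (∑' j : ℕ, star T ^ j) * Y) * (1 - T) =
        star T * Y * (1 - T) := by
      have : (1 - star T) * star T = star T * (1 - star T) := by noncomm_ring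
      rw [← mul_assoc, ← mul_assoc, this, mul_assoc (star T), e2, mul_one]
    rw [e3, e4]
    noncomm_ring

/-- **Factorization of the Poisson kernel** of a tuple of commuting strict contractions. -/
theorem conj_tsum_poissonTerm {k : ℕ} (T : Fin k → 𝒜) (hT : ∀ i j, Commute (T i) (T j))
    (h1 : ∀ i, ‖T i‖ < 1) :
    star (List.ofFn fun i => 1 - T i).prod * (∑' m, poissonTerm T m) *
      (List.ofFn fun i => 1 - T i).prod =
    (List.ofFn fun i => (1 - conjMap (T i) : Module.End ℂ 𝒜)).prod 1 := by
  induction k with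
  | zero => simp [poissonTerm]
  | succ k ih =>
    have hs := (summable_norm_poissonTerm T hT h1).of_norm
    have hs' := (summable_norm_poissonTerm (fun i => T i.succ) (fun i j => hT _ _)
      fun i => h1 _).of_norm
    have ih := ih (fun i => T i.succ) (fun i j => hT _ _) fun i => h1 _
    set S := ∑' m, poissonTerm (fun i => T i.succ) m with hS
    set B := (List.ofFn fun i : Fin k => 1 - T i.succ).prod with hB
    obtain ⟨Q, hQ, hQ1⟩ := exists_hasSum_conj (T 0) S (h1 0)
    have hfib : ∀ a : ℤ, HasSum
        (fun m : Fin k → ℤ => poissonTerm T (Fin.cons a m : Fin (k + 1) → ℤ))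
        (star (T 0) ^ (-a).toNat * S * T 0 ^ a.toNat) := by
      intro a
      have h := (hs'.hasSum.mul_left (star (T 0) ^ (-a).toNat)).mul_right (T 0 ^ a.toNat)
      have h2 : (fun m : Fin k → ℤ => poissonTerm T (Fin.cons a m : Fin (k + 1) → ℤ)) =
        fun m : Fin k → ℤ => star (T 0) ^ (-a).toNat * poissonTerm (fun i => T i.succ) m *
          T 0 ^ a.toNat := funext fun m => poissonTerm_cons T hT a m
      rw [h2]
      exact h
    have hsum : ∑' m, poissonTerm T m = Q := by
      have h3 := (Fin.consEquiv fun _ : Fin (k + 1) => ℤ).hasSum_iff.2 hs.hasSum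
      have h4 : (poissonTerm T ∘ (Fin.consEquiv fun _ : Fin (k + 1) => ℤ)) =
          fun p : ℤ × (Fin k → ℤ) => poissonTerm T (Fin.cons p.1 p.2 : Fin (k + 1) → ℤ) := by
        funext p
        rfl
      rw [h4] at h3
      exact (HasSum.prod_fiberwise h3 hfib).unique hQ
    -- This lets the conjugation by `B` pass inside the conjugation by `T 0`, where the induction
    -- hypothesis applies.
    have hc : Commute (T 0) B := by
      refine Commute.list_prod_right _ _ fun y hy => ?_
      obtain ⟨i, rfl⟩ := (List.mem_ofFn' _ _).1 hy
      exact (Commute.one_right _).sub_right (hT 0 i.succ)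
    rw [List.ofFn_succ, List.ofFn_succ, List.prod_cons, List.prod_cons, hsum, Module.End.mul_apply,
      ← ih, LinearMap.sub_apply, Module.End.one_apply, conjMap_apply, star_mul]
    calc _ = star B * (star (1 - T 0) * Q * (1 - T 0)) * B := by simp only [mul_assoc, hB]
      _ = star B * S * B - (star B * star (T 0)) * S * (T 0 * B) := by rw [hQ1]; noncomm_ring
      _ = _ := by rw [← star_mul, hc.eq, star_mul]; simp only [mul_assoc]

end AbstractPoisson

/-! ### Row operators `∑_j R_j ⊗ X_j^*` and the creation operators on Fock space. -/

section RowOperators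

theorem sum_prod_ofFn {R : Type*} [Semiring R] {k : ℕ} {ι : Fin k → Type*} [∀ i, Fintype (ι i)]
    (g : (i : Fin k) → ι i → R) :
    ∑ f : (i : Fin k) → ι i, (List.ofFn fun i => g i (f i)).prod =
      (List.ofFn fun i => ∑ j, g i j).prod := by
  induction k with
  | zero => simp
  | succ k ih =>
    rw [← (Fin.consEquiv ι).sum_comp, Fintype.sum_prod_type, List.ofFn_succ, List.prod_cons,
      ← ih fun i => g i.succ, Finset.sum_mul]
    refine Finset.sum_congr rfl fun a _ => ?_
    rw [Finset.mul_sum]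
    refine Finset.sum_congr rfl fun f _ => ?_
    simp [Fin.consEquiv]

theorem star_prod_map_reverse {R ι : Type*} [Monoid R] [StarMul R] (l : List ι) (f : ι → R) :
    star (l.reverse.map f).prod = (l.map fun i => star (f i)).prod := by
  induction l with
  | nil => simp
  | cons a l ih =>
    rw [List.reverse_cons, List.map_append, List.prod_append, star_mul, ih]
    simp

section RowOp

variable {E : Type*} [NormedAddCommGroup E] [InnerProductSpace ℂ E]
  {K : Type*} [NormedAddCommGroup K] [InnerProductSpace ℂ K]

theorem opTensor_prod_ofFn {k : ℕ} (S : Fin k → E →L[ℂ] E) (T : Fin k → K →L[ℂ] K) :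
    opTensor (List.ofFn S).prod (List.ofFn T).prod =
      (List.ofFn fun i => opTensor (S i) (T i)).prod := by
  rw [List.ofFn_eq_map, List.ofFn_eq_map, List.ofFn_eq_map, opTensor_list_prod]

variable [CompleteSpace E] [CompleteSpace K]

/-- The operator `∑_j R_j ⊗ X_j^*`. -/
def rowOp {m : ℕ} (R : Fin m → E →L[ℂ] E) (X : Fin m → K →L[ℂ] K) :
    HTensor E K →L[ℂ] HTensor E K :=
  ∑ j, opTensor (R j) (star (X j))

theorem star_rowOp {m : ℕ} (R : Fin m → E →L[ℂ] E) (X : Fin m → K →L[ℂ] K) :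
    star (rowOp R X) = ∑ j, opTensor (star (R j)) (X j) := by
  simp only [rowOp, hTensor_star_sum, star_opTensor, star_star]

theorem star_wordOp_reverse {m : ℕ} (R : Fin m → E →L[ℂ] E) (l : List (Fin m)) :
    star (wordOp R l.reverse) = (l.map fun j => star (R j)).prod :=
  star_prod_map_reverse l R

/-- The reversed word in the Poisson coefficients undoes the reversal caused by the adjoint, so both
tensor factors multiply in the same order. -/
theorem star_rowOp_pow {m : ℕ} (R : Fin m → E →L[ℂ] E) (X : Fin m → K →L[ℂ] K) (p : ℕ) :
    star (rowOp R X) ^ p = ∑ α : Fin p → Fin m,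
      opTensor (star (wordOp R (List.ofFn α).reverse)) (wordOp X (List.ofFn α)) := by
  have h := sum_prod_ofFn (k := p) fun _ j => opTensor (star (R j)) (X j)
  rw [List.ofFn_const, List.prod_replicate, ← star_rowOp] at h
  rw [← h]
  refine Finset.sum_congr rfl fun α _ => ?_
  rw [star_wordOp_reverse, wordOp, List.map_ofFn, List.map_ofFn, opTensor_prod_ofFn]
  rfl

theorem rowOp_pow {m : ℕ} (R : Fin m → E →L[ℂ] E) (X : Fin m → K →L[ℂ] K) (p : ℕ) :
    rowOp R X ^ p = ∑ β : Fin p → Fin m,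
      opTensor (wordOp R (List.ofFn β).reverse) (star (wordOp X (List.ofFn β))) := by
  have h := congrArg star (star_rowOp_pow R X p)
  rw [hTensor_star_pow, hTensor_star_star] at h
  rw [h, hTensor_star_sum]
  simp only [star_opTensor, star_star]

omit [CompleteSpace E] in
theorem rowOp_commute {m m' : ℕ} {R : Fin m → E →L[ℂ] E} {X : Fin m → K →L[ℂ] K}
    {R' : Fin m' → E →L[ℂ] E} {X' : Fin m' → K →L[ℂ] K}
    (hR : ∀ a b, R a * R' b = R' b * R a) (hX : ∀ a b, X a * X' b = X' b * X a) :
    Commute (rowOp R X) (rowOp R' X') := by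
  rw [Commute, SemiconjBy, rowOp, rowOp, Finset.sum_mul_sum, Finset.sum_mul_sum, Finset.sum_comm]
  refine Finset.sum_congr rfl fun b _ => Finset.sum_congr rfl fun a _ => ?_
  rw [← opTensor_mul, ← opTensor_mul, hR, ← star_mul, ← star_mul, hX]

/-- Isometries with orthogonal ranges kill the off-diagonal terms. -/
theorem conjMap_rowOp_ampliation {m : ℕ} {R : Fin m → E →L[ℂ] E} (X : Fin m → K →L[ℂ] K)
    (hR : ∀ a b, star (R a) * R b = if a = b then 1 else 0) (Y : K →L[ℂ] K) :
    conjMap (rowOp R X) (ampliation E K Y) = ampliation E K (Phi X Y) := by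
  rw [conjMap_apply, star_rowOp, rowOp, Finset.sum_mul, Finset.sum_mul_sum, Phi_apply, map_sum]
  refine Finset.sum_congr rfl fun a _ => ?_
  rw [Finset.sum_eq_single a]
  · rw [ampliation_apply, ← opTensor_mul, ← opTensor_mul, mul_one, hR, if_pos rfl,
      ampliation_apply]
  · intro b _ hb
    rw [ampliation_apply, ← opTensor_mul, ← opTensor_mul, mul_one, hR, if_neg hb.symm,
      opTensor_zero_left]
  · simp

theorem ampliation_Phi_pow {m : ℕ} {R : Fin m → E →L[ℂ] E} (X : Fin m → K →L[ℂ] K)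
    (hR : ∀ a b, star (R a) * R b = if a = b then 1 else 0) (p : ℕ) (Y : K →L[ℂ] K) :
    ampliation E K ((Phi X ^ p) Y) = star (rowOp R X ^ p) * ampliation E K Y * rowOp R X ^ p := by
  induction p with
  | zero => simp [hTensor_star_one]
  | succ p ih =>
    rw [pow_succ', Module.End.mul_apply, ← conjMap_rowOp_ampliation X hR, ih, conjMap_apply,
      pow_succ, hTensor_star_mul]
    simp only [mul_assoc]

theorem Phi_pow_one {m : ℕ} (X : Fin m → K →L[ℂ] K) (p : ℕ) :
    (Phi X ^ p) 1 =
      ∑ β : Fin p → Fin m, wordOp X (List.ofFn β) * star (wordOp X (List.ofFn β)) := by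
  induction p with
  | zero => simp [wordOp]
  | succ p ih =>
    rw [pow_succ', Module.End.mul_apply, ih, Phi_apply, ← (Fin.consEquiv fun _ => Fin m).sum_comp,
      Fintype.sum_prod_type]
    refine Finset.sum_congr rfl fun a _ => ?_
    rw [Finset.mul_sum, Finset.sum_mul]
    refine Finset.sum_congr rfl fun f _ => ?_
    have : List.ofFn ((Fin.consEquiv fun _ : Fin (p + 1) => Fin m) (a, f)) = a :: List.ofFn f := by
      rw [List.ofFn_succ]; simp [Fin.consEquiv]
    rw [this]
    simp [wordOp, mul_assoc]

/-- The C*-identity applied to `T^{*p} T^p = I ⊗ Φ^p(I)`. It turns the joint spectral radius of the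
tuple into the spectral radius of one operator. -/
theorem norm_rowOp_pow_sq [Nontrivial E] {m : ℕ} {R : Fin m → E →L[ℂ] E} (X : Fin m → K →L[ℂ] K)
    (hR : ∀ a b, star (R a) * R b = if a = b then 1 else 0) (p : ℕ) :
    ‖rowOp R X ^ p‖ ^ 2 = ‖(Phi X ^ p) 1‖ := by
  rw [← norm_ampliation (E := E) ((Phi X ^ p) 1), ampliation_Phi_pow X hR, map_one, mul_one,
    CStarRing.norm_star_mul_self (E := HTensor E K →L[ℂ] HTensor E K), sq]

end RowOp

section Fock

variable {k : ℕ} {n : Fin k → ℕ}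

theorem fock_ext {F : Type*} [NormedAddCommGroup F] [NormedSpace ℂ F]
    {S T : FockTensor n →L[ℂ] F} (h : ∀ α, S (fockBasis α) = T (fockBasis α)) : S = T := by
  refine lp.ext_continuousLinearMap ENNReal.ofNat_ne_top fun α => ?_
  ext
  exact h α

theorem inner_fockBasis (α β : Words n) :
    inner ℂ (fockBasis α) (fockBasis β) = if α = β then (1 : ℂ) else 0 :=
  orthonormal_iff_ite.1 orthonormal_fockBasis α β

theorem appendLetter_eq_iff {i : Fin k} {a b : Fin (n i)} {α β : Words n} :
    appendLetter i a α = appendLetter i b β ↔ a = b ∧ α = β := by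
  refine ⟨fun h => ?_, fun h => by rw [h.1, h.2]⟩
  have hi := congrFun h i
  simp only [appendLetter, Function.update_self] at hi
  obtain rfl : a = b := by simpa using (List.append_inj' hi rfl).2
  exact ⟨rfl, appendLetter_injective i a h⟩

theorem rightCreation_comm {i s : Fin k} (h : i ≠ s) (a : Fin (n i)) (b : Fin (n s)) :
    (rightCreation i a * rightCreation s b : FockTensor n →L[ℂ] FockTensor n) =
      rightCreation s b * rightCreation i a := by
  refine fock_ext fun α => ?_
  simp only [mul_apply_eq_comp, rightCreation_fockBasis]
  congr 1
  funext l
  by_cases h1 : l = i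
  · subst h1; simp [appendLetter, h]
  · by_cases h2 : l = s
    · subst h2; simp [appendLetter, h.symm]
    · simp [appendLetter, h1, h2]

theorem star_rightCreation_mul (i : Fin k) (a b : Fin (n i)) :
    star (rightCreation i a) * rightCreation i b =
      (if a = b then 1 else 0 : FockTensor n →L[ℂ] FockTensor n) := by
  refine fock_ext fun α => ?_
  ext β
  have hcoord : ∀ v : FockTensor n, v β = inner ℂ (fockBasis β) v := fun v => by
    rw [fockBasis, lp.inner_single_left]; simp
  rw [hcoord, hcoord, mul_apply_eq_comp, ContinuousLinearMap.star_eq_adjoint,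
    ContinuousLinearMap.adjoint_inner_right, rightCreation_fockBasis, rightCreation_fockBasis,
    inner_fockBasis]
  by_cases hab : a = b
  · subst hab
    simp [appendLetter_eq_iff, inner_fockBasis]
  · simp [appendLetter_eq_iff, hab]

instance : Nontrivial (FockTensor n) :=
  ⟨⟨fockBasis fun _ => [], 0, (orthonormal_fockBasis (n := n)).ne_zero _⟩⟩

/-- The block of multi-degree `m` of the Poisson kernel is a monomial in the operators
`∑_j R_{i,j} ⊗ X_{i,j}^*` and their adjoints. -/
theorem block_poissonCoeff {K : Type*} [NormedAddCommGroup K] [InnerProductSpace ℂ K]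
    [CompleteSpace K] (X : OpTuple n K) (m : Fin k → ℤ) :
    block poissonCoeff X m = poissonTerm (fun i => rowOp (rightCreation (n := n) i) (X i)) m := by
  have h1 := sum_prod_ofFn fun (i : Fin k) (α : Fin (-(m i)).toNat → Fin (n i)) =>
    opTensor (star (wordOp (rightCreation (n := n) i) (List.ofFn α).reverse))
      (wordOp (X i) (List.ofFn α))
  have h2 := sum_prod_ofFn fun (i : Fin k) (β : Fin (m i).toNat → Fin (n i)) =>
    opTensor (wordOp (rightCreation (n := n) i) (List.ofFn β).reverse)
      (star (wordOp (X i) (List.ofFn β)))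
  simp only [← star_rowOp_pow] at h1
  simp only [← rowOp_pow] at h2
  rw [poissonTerm, ← h1, ← h2, block, Finset.sum_mul_sum]
  refine Finset.sum_congr rfl fun α _ => Finset.sum_congr rfl fun β _ => ?_
  rw [poissonCoeff, opTensor_mul]
  simp only [multiWordOp, multiWordOpStar, opTensor_prod_ofFn]

theorem rowOp_rightCreation_commute {K : Type*} [NormedAddCommGroup K] [InnerProductSpace ℂ K]
    [CompleteSpace K] {X : OpTuple n K}
    (hX : ∀ s t : Fin k, s ≠ t → ∀ a b, X s a * X t b = X t b * X s a) (i j : Fin k) :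
    Commute (rowOp (rightCreation (n := n) i) (X i)) (rowOp (rightCreation (n := n) j) (X j)) := by
  by_cases h : i = j
  · subst h; rfl
  · exact rowOp_commute (rightCreation_comm h) (hX i j h)

theorem prod_conjMap_rowOp {K : Type*} [NormedAddCommGroup K] [InnerProductSpace ℂ K]
    [CompleteSpace K] (X : OpTuple n K) :
    (List.ofFn fun i => (1 - conjMap (rowOp (rightCreation (n := n) i) (X i)) :
      Module.End ℂ (HTensor (FockTensor n) K →L[ℂ] HTensor (FockTensor n) K))).prod 1 =
      ampliation (FockTensor n) K (defectMap X 1) := by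
  rw [defectMap, List.ofFn_eq_map, List.ofFn_eq_map]
  induction List.finRange k with
  | nil => simp
  | cons i l ih =>
    rw [List.map_cons, List.map_cons, List.prod_cons, List.prod_cons, Module.End.mul_apply,
      Module.End.mul_apply, ih, LinearMap.sub_apply, LinearMap.sub_apply, Module.End.one_apply,
      Module.End.one_apply, map_sub, conjMap_rowOp_ampliation _ (star_rightCreation_mul i)]

end Fock

end RowOperators

/-! ### Order and invertibility in C*-algebras. -/

section CStar

variable {𝒜 : Type*} [CStarAlgebra 𝒜] [PartialOrder 𝒜] [StarOrderedRing 𝒜]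

omit [PartialOrder 𝒜] [StarOrderedRing 𝒜] in
theorem norm_star_mul_mul_le (S Y : 𝒜) : ‖star S * Y * S‖ ≤ ‖S‖ ^ 2 * ‖Y‖ := by
  refine norm_mul₃_le.trans ?_
  rw [norm_star, sq]
  exact (by ring : _ = _).le

theorem ofReal_smul_nonneg {c : ℝ} (hc : 0 ≤ c) {x : 𝒜} (hx : 0 ≤ x) : 0 ≤ (c : ℂ) • x := by
  have h : (c : ℂ) • x = star (((Real.sqrt c : ℝ) : ℂ) • (1 : 𝒜)) * x *
      (((Real.sqrt c : ℝ) : ℂ) • (1 : 𝒜)) := by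
    rw [star_smul, star_one, smul_mul_assoc, one_mul, mul_smul_one, smul_smul, Complex.star_def,
      Complex.conj_ofReal, ← Complex.ofReal_mul, Real.mul_self_sqrt hc]
  rw [h]
  exact star_left_conjugate_nonneg hx _

theorem ofReal_smul_le_smul {c : ℝ} (hc : 0 ≤ c) {x y : 𝒜} (h : x ≤ y) :
    (c : ℂ) • x ≤ (c : ℂ) • y := by
  have := ofReal_smul_nonneg hc (sub_nonneg.2 h)
  rwa [smul_sub, sub_nonneg] at this

theorem ofReal_smul_mono {c d : ℝ} (h : c ≤ d) {x : 𝒜} (hx : 0 ≤ x) :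
    (c : ℂ) • x ≤ (d : ℂ) • x := by
  have := ofReal_smul_nonneg (sub_nonneg.2 h) hx
  rwa [Complex.ofReal_sub, sub_smul, sub_nonneg] at this

theorem norm_le_of_nonneg_of_le_smul_one {x : 𝒜} {c : ℝ} (hc : 0 ≤ c) (hx : 0 ≤ x)
    (h : x ≤ (c : ℂ) • (1 : 𝒜)) : ‖x‖ ≤ c := by
  rcases subsingleton_or_nontrivial 𝒜 with _ | _
  · rwa [Subsingleton.elim x 0, norm_zero]
  refine (CStarAlgebra.norm_le_norm_of_nonneg_of_le hx h).trans ?_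
  rw [norm_smul, norm_one, mul_one, Complex.norm_real, Real.norm_of_nonneg hc]

theorem nonneg_iff_star_mul_mul_nonneg {B P : 𝒜} (hB : IsUnit B) : 0 ≤ star B * P * B ↔ 0 ≤ P :=
  hB.star_left_conjugate_nonneg_iff

theorem exists_smul_one_le_star_mul_self {B : 𝒜} (hB : IsUnit B) :
    ∃ b : ℝ, 0 < b ∧ (b : ℂ) • (1 : 𝒜) ≤ star B * B := by
  obtain ⟨u, rfl⟩ := hB
  -- The summand 1 keeps `c` positive even in the zero algebra.
  set c : ℝ := ‖((u⁻¹ : 𝒜ˣ) : 𝒜)‖ ^ 2 + 1 with hc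
  have hc0 : 0 < c := by positivity
  have h1 : star ((u⁻¹ : 𝒜ˣ) : 𝒜) * ((u⁻¹ : 𝒜ˣ) : 𝒜) ≤ (c : ℂ) • 1 := by
    refine CStarAlgebra.star_mul_le_algebraMap_norm_sq.trans ?_
    rw [IsScalarTower.algebraMap_apply ℝ ℂ 𝒜, Algebra.algebraMap_eq_smul_one]
    exact ofReal_smul_mono (by simp [hc]) zero_le_one
  have h2 := star_left_conjugate_le_conjugate h1 (u : 𝒜)
  have h3 : star (u : 𝒜) * (star ((u⁻¹ : 𝒜ˣ) : 𝒜) * ((u⁻¹ : 𝒜ˣ) : 𝒜)) * u = 1 := by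
    rw [← mul_assoc, ← star_mul, mul_assoc]; simp
  rw [h3, mul_smul_one, smul_mul_assoc] at h2
  refine ⟨c⁻¹, inv_pos.2 hc0, ?_⟩
  refine (ofReal_smul_le_smul (inv_pos.2 hc0).le h2).trans_eq ?_
  rw [smul_smul, ← Complex.ofReal_mul, inv_mul_cancel₀ hc0.ne', Complex.ofReal_one, one_smul]

theorem exists_smul_one_le_of_isUnit {x : 𝒜} (h0 : 0 ≤ x) (hx : IsUnit x) :
    ∃ b : ℝ, 0 < b ∧ (b : ℂ) • (1 : 𝒜) ≤ x := by
  rcases subsingleton_or_nontrivial 𝒜 with _ | _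
  · exact ⟨1, one_pos, (Subsingleton.elim _ _).le⟩
  obtain ⟨b, hb, h⟩ := (CFC.exists_pos_algebraMap_le_iff (.of_nonneg h0)).2 (by
    intro t ht
    exact lt_of_le_of_ne (spectrum_nonneg_of_nonneg h0 ht) fun h =>
      spectrum.zero_notMem ℝ hx (h ▸ ht))
  refine ⟨b, hb, ?_⟩
  rwa [IsScalarTower.algebraMap_apply ℝ ℂ 𝒜, Algebra.algebraMap_eq_smul_one] at h

theorem isUnit_of_smul_one_le {x : 𝒜} {b : ℝ} (hb : 0 < b) (h : (b : ℂ) • (1 : 𝒜) ≤ x) :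
    IsUnit x := by
  refine CStarAlgebra.isUnit_of_le _ h ?_
  refine ⟨ofReal_smul_nonneg hb.le zero_le_one, ?_⟩
  have : (b : ℂ) ≠ 0 := by exact_mod_cast hb.ne'
  exact (Units.mk0 _ this • (1 : 𝒜ˣ)).isUnit

-- `1 - T^p` is `1 - T` times a geometric sum commuting with it.
omit [PartialOrder 𝒜] [StarOrderedRing 𝒜] in
theorem isUnit_one_sub_of_norm_pow_lt_one {T : 𝒜} {p : ℕ} (h : ‖T ^ p‖ < 1) : IsUnit (1 - T) := by
  have h1 := isUnit_one_sub_of_norm_lt_one h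
  rw [← mul_neg_geom_sum] at h1
  refine (Commute.isUnit_mul_iff ?_).1 h1 |>.1
  rw [Commute, SemiconjBy, mul_neg_geom_sum, geom_sum_mul_neg]

end CStar

/-! ### Factorization and positivity of the free Poisson kernel. -/

section Poisson

variable {k : ℕ} {n : Fin k → ℕ} {K : Type*} [NormedAddCommGroup K] [InnerProductSpace ℂ K]
  [CompleteSpace K]

/-- The operators `∑_j R_{i,j} ⊗ X_{i,j}^*`. -/
def poissonRow (X : OpTuple n K) (i : Fin k) :
    HTensor (FockTensor n) K →L[ℂ] HTensor (FockTensor n) K :=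
  rowOp (rightCreation (n := n) i) (X i)

/-- The product of the operators `I - ∑_j R_{i,j} ⊗ X_{i,j}^*`. -/
def poissonDenom (X : OpTuple n K) : HTensor (FockTensor n) K →L[ℂ] HTensor (FockTensor n) K :=
  (List.ofFn fun i => 1 - poissonRow X i).prod

/-- Entries of the tuple with different first index commute. -/
def CrossCommute (X : OpTuple n K) : Prop :=
  ∀ s t : Fin k, s ≠ t → ∀ a b, X s a * X t b = X t b * X s a

theorem norm_poissonRow_pow_sq (X : OpTuple n K) (i : Fin k) (p : ℕ) :
    ‖poissonRow X i ^ p‖ ^ 2 = ‖(Phi (X i) ^ p) 1‖ :=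
  norm_rowOp_pow_sq (X i) (star_rightCreation_mul i) p

theorem norm_poissonRow_sq (X : OpTuple n K) (i : Fin k) :
    ‖poissonRow X i‖ ^ 2 = ‖∑ j, X i j * star (X i j)‖ := by
  have := norm_poissonRow_pow_sq X i 1
  simpa [Phi_apply] using this

theorem summable_block_poissonCoeff {X : OpTuple n K} (hX : CrossCommute X)
    (h1 : ∀ i, ‖poissonRow X i‖ < 1) : Summable fun m => block poissonCoeff X m := by
  have h : (fun m => block poissonCoeff X m) = fun m => poissonTerm (poissonRow X) m :=
    funext fun m => block_poissonCoeff X m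
  rw [h]
  have h2 := summable_norm_poissonTerm (poissonRow X) (rowOp_rightCreation_commute hX) h1
  exact h2.of_norm

theorem poissonKernel_eq (X : OpTuple n K) :
    poissonKernel X = ∑' m, poissonTerm (poissonRow X) m := by
  simp only [poissonKernel, evalAt, block_poissonCoeff]
  rfl

theorem conj_poissonKernel {X : OpTuple n K} (hX : CrossCommute X)
    (h1 : ∀ i, ‖poissonRow X i‖ < 1) :
    star (poissonDenom X) * poissonKernel X * poissonDenom X =
      ampliation (FockTensor n) K (defectMap X 1) := by
  rw [poissonKernel_eq, ← prod_conjMap_rowOp]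
  exact conj_tsum_poissonTerm (poissonRow X) (rowOp_rightCreation_commute hX) h1

theorem isUnit_poissonDenom {X : OpTuple n K} (h : ∀ i, IsUnit (1 - poissonRow X i)) :
    IsUnit (poissonDenom X) := by
  refine List.prod_isUnit fun y hy => ?_
  obtain ⟨i, rfl⟩ := (List.mem_ofFn' _ _).1 hy
  exact h i

theorem norm_poissonRow_lt_one_iff {X : OpTuple n K} {i : Fin k} :
    ‖poissonRow X i‖ < 1 ↔ Real.sqrt ‖∑ j, X i j * star (X i j)‖ < 1 := by
  rw [← norm_poissonRow_sq, Real.sqrt_sq (norm_nonneg (poissonRow X i))]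

/-- The kernel is congruent, through the invertible `poissonDenom X`, to `I ⊗ Δ_X(I)`. -/
theorem poissonKernel_isPositive {X : OpTuple n K} (hX : X ∈ openPolyball n K) :
    (poissonKernel X).IsPositive := by
  have h1 : ∀ i, ‖poissonRow X i‖ < 1 := fun i => norm_poissonRow_lt_one_iff.2 (hX.2.1 i)
  have h2 := conj_poissonKernel hX.1 h1
  have h3 : 0 ≤ ampliation (FockTensor n) K (defectMap X 1) :=
    ampliation_nonneg_iff.2 ((ContinuousLinearMap.nonneg_iff_isPositive _).2 hX.2.2.1)
  rw [← h2] at h3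
  exact (ContinuousLinearMap.nonneg_iff_isPositive _).1 ((nonneg_iff_star_mul_mul_nonneg
    (isUnit_poissonDenom fun i => isUnit_one_sub_of_norm_lt_one
      (R := HTensor (FockTensor n) K →L[ℂ] HTensor (FockTensor n) K) (h1 i))).1 h3)

theorem isFreePluriharmonic_poissonCoeff : IsFreePluriharmonic.{u} (poissonCoeff (n := n)) := by
  intro K _ _ _ X hX
  exact summable_block_poissonCoeff hX.1 fun i => norm_poissonRow_lt_one_iff.2 (hX.2.1 i)

theorem isPositiveOnPolyball_poissonCoeff :
    IsPositiveOnPolyball.{u} (poissonCoeff (n := n)) := by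
  intro K _ _ _ X hX
  exact poissonKernel_isPositive hX

instance : TopologicalSpace.SeparableSpace (FockTensor n) := by
  have b : HilbertBasis (Words n) ℂ (FockTensor n) :=
    HilbertBasis.ofRepr (LinearIsometryEquiv.refl ℂ _)
  have h := ((Set.countable_range b).isSeparable.span (R := ℂ)).closure
  rw [← Submodule.topologicalClosure_coe, b.dense_span] at h
  exact TopologicalSpace.isSeparable_univ_iff.1 h

/-- The Poisson kernel is itself a positive free pluriharmonic function, with coefficients on the
separable space `FockTensor n`. -/
theorem HarnackDominated.poissonDominated {H : Type u} [NormedAddCommGroup H]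
    [InnerProductSpace ℂ H] [CompleteSpace H] {A B : OpTuple n H} (h : HarnackDominated A B) :
    PoissonDominated A B := by
  obtain ⟨c, hc, h⟩ := h
  exact ⟨c, hc, fun r h0 h1 => h (FockTensor n) poissonCoeff isFreePluriharmonic_poissonCoeff
    isPositiveOnPolyball_poissonCoeff r h0 h1⟩

end Poisson

/-! ### Removing factors `1 - Φ_j` from a lower bound on the defect. -/

section Stripping

variable {K : Type*} [NormedAddCommGroup K] [InnerProductSpace ℂ K] [CompleteSpace K]

theorem Phi_nonneg {m : ℕ} (X : Fin m → K →L[ℂ] K) {Y : K →L[ℂ] K} (hY : 0 ≤ Y) :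
    0 ≤ Phi X Y := by
  rw [Phi_apply]
  exact Finset.sum_nonneg fun j _ => star_right_conjugate_nonneg hY _

theorem Phi_mono {m : ℕ} (X : Fin m → K →L[ℂ] K) {Y Z : K →L[ℂ] K} (h : Y ≤ Z) :
    Phi X Y ≤ Phi X Z := by
  have := Phi_nonneg X (sub_nonneg.2 h)
  rwa [map_sub, sub_nonneg] at this

theorem Phi_pow_nonneg {m : ℕ} (X : Fin m → K →L[ℂ] K) (p : ℕ) {Y : K →L[ℂ] K} (hY : 0 ≤ Y) :
    0 ≤ (Phi X ^ p) Y := by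
  induction p with
  | zero => simpa using hY
  | succ p ih => rw [pow_succ', Module.End.mul_apply]; exact Phi_nonneg X ih

/-- Iterating the positive map `Φ` telescopes to `Z ≤ Y - Φ^{q+1}(Y)`, since the terms `Φ^j(Z)` are
nonnegative. Decay along a subsequence of powers suffices. -/
theorem le_of_le_sub_Phi {m : ℕ} {X : Fin m → K →L[ℂ] K} {Y Z : K →L[ℂ] K} (hZ : 0 ≤ Z)
    (h : Z ≤ Y - Phi X Y) {u : ℕ → ℕ}
    (hu : Filter.Tendsto (fun l => (Phi X ^ (u l + 1)) Y) Filter.atTop (nhds 0)) : Z ≤ Y := by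
  have key : ∀ q : ℕ, Z ≤ Y - (Phi X ^ (q + 1)) Y := by
    intro q
    induction q with
    | zero => simpa using h
    | succ q ih =>
      have h1 := (Phi_nonneg X hZ).trans (Phi_mono X ih)
      rw [map_sub, ← Module.End.mul_apply, ← pow_succ'] at h1
      have h2 := add_le_add h h1
      rwa [add_zero, sub_add_sub_cancel] at h2
  have hl := (tendsto_const_nhds (x := Y)).sub hu
  rw [sub_zero] at hl
  exact ge_of_tendsto' hl fun l => key (u l)

variable {k : ℕ} {n : Fin k → ℕ}

theorem norm_Phi_pow_apply_le (X : OpTuple n K) (i : Fin k) (p : ℕ) (Y : K →L[ℂ] K) :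
    ‖(Phi (X i) ^ p) Y‖ ≤ ‖poissonRow X i ^ p‖ ^ 2 * ‖Y‖ := by
  have h := ampliation_Phi_pow (X i) (star_rightCreation_mul (n := n) i) p Y
  have h2 := norm_ampliation (E := FockTensor n) ((Phi (X i) ^ p) Y)
  rw [← h2, h]
  refine (norm_star_mul_mul_le (𝒜 := HTensor (FockTensor n) K →L[ℂ] HTensor (FockTensor n) K)
    _ _).trans ?_
  rw [norm_ampliation, poissonRow]

theorem tendsto_Phi_pow_apply {X : OpTuple n K} {i : Fin k} {p : ℕ} (hp : 1 ≤ p)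
    (h : ‖poissonRow X i ^ p‖ < 1) (Y : K →L[ℂ] K) :
    Filter.Tendsto (fun l => (Phi (X i) ^ ((p * (l + 1) - 1) + 1)) Y) Filter.atTop (nhds 0) := by
  rw [tendsto_zero_iff_norm_tendsto_zero]
  have h0 : Filter.Tendsto (fun l : ℕ => (‖poissonRow X i ^ p‖ ^ (l + 1)) ^ 2 * ‖Y‖) Filter.atTop
      (nhds ((0 : ℝ) ^ 2 * ‖Y‖)) :=
    ((((tendsto_pow_atTop_nhds_zero_of_lt_one (norm_nonneg (poissonRow X i ^ p)) h).comp
      (Filter.tendsto_add_atTop_nat 1)).pow 2).mul_const _)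
  rw [zero_pow two_ne_zero, zero_mul] at h0
  refine squeeze_zero (fun _ => norm_nonneg _) (fun l => ?_) h0
  have h2 : p * (l + 1) - 1 + 1 = p * (l + 1) := Nat.sub_add_cancel (Nat.mul_pos hp l.succ_pos)
  rw [h2]
  refine (norm_Phi_pow_apply_le X i _ Y).trans ?_
  rw [pow_mul]
  gcongr
  exact norm_pow_le' (poissonRow X i ^ p) l.succ_pos

theorem Phi_commute {X : OpTuple n K} (hX : CrossCommute X) (i j : Fin k) :
    Commute (Phi (X i)) (Phi (X j)) := by
  by_cases h : i = j
  · subst h; rfl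
  ext1 Y
  simp only [Module.End.mul_apply, Phi_apply, Finset.mul_sum, Finset.sum_mul]
  rw [Finset.sum_comm]
  refine Finset.sum_congr rfl fun a _ => Finset.sum_congr rfl fun b _ => ?_
  calc X i b * (X j a * Y * star (X j a)) * star (X i b)
      = (X i b * X j a) * Y * star (X i b * X j a) := by rw [star_mul]; simp only [mul_assoc]
    _ = _ := by rw [hX i j h b a, star_mul]; simp only [mul_assoc]

theorem le_of_le_prod_apply {X : OpTuple n K}
    (h : ∀ i, ∃ p, 1 ≤ p ∧ ‖poissonRow X i ^ p‖ < 1) {Z : K →L[ℂ] K} (hZ : 0 ≤ Z)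
    (l : List (Fin k)) (Y : K →L[ℂ] K)
    (hY : Z ≤ (l.map fun i => (1 - Phi (X i) : Module.End ℂ (K →L[ℂ] K))).prod Y) : Z ≤ Y := by
  induction l with
  | nil => simpa using hY
  | cons i l ih =>
    refine ih ?_
    obtain ⟨p, hp, hlt⟩ := h i
    exact le_of_le_sub_Phi hZ hY (tendsto_Phi_pow_apply hp hlt _)

/-- The `Φ_j` commute, so the `i`-th factor can be moved innermost, next to `1`, and all the others
stripped from the outside. -/
theorem le_one_sub_Phi {X : OpTuple n K} (hX : CrossCommute X)
    (h : ∀ i, ∃ p, 1 ≤ p ∧ ‖poissonRow X i ^ p‖ < 1) {Z : K →L[ℂ] K} (hZ : 0 ≤ Z)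
    (hD : Z ≤ defectMap X 1) (i : Fin k) : Z ≤ 1 - Phi (X i) 1 := by
  obtain ⟨l₁, l₂, hl⟩ := List.append_of_mem (List.mem_finRange i)
  refine le_of_le_prod_apply h hZ (l₁ ++ l₂) _ ?_
  have hc : Commute (1 - Phi (X i) : Module.End ℂ (K →L[ℂ] K))
      (l₂.map fun i => (1 - Phi (X i) : Module.End ℂ (K →L[ℂ] K))).prod := by
    refine Commute.list_prod_right _ _ fun y hy => ?_
    obtain ⟨j, _, rfl⟩ := List.mem_map.1 hy
    exact ((Commute.one_left _).sub_left
      ((Commute.one_right _).sub_right (Phi_commute hX i j)))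
  have h2 : (1 - Phi (X i) (1 : K →L[ℂ] K)) = (1 - Phi (X i) : Module.End ℂ (K →L[ℂ] K)) 1 := rfl
  rw [h2, ← Module.End.mul_apply, List.map_append, List.prod_append, mul_assoc, ← hc.eq,
    ← List.prod_cons, ← List.map_cons (f := fun i => (1 - Phi (X i) : Module.End ℂ (K →L[ℂ] K))),
    ← List.prod_append, ← List.map_append, ← hl]
  rwa [defectMap, List.ofFn_eq_map] at hD

theorem mem_openPolyball_of_smul_one_le {X : OpTuple n K} (hX : CrossCommute X)
    (h : ∀ i, ∃ p, 1 ≤ p ∧ ‖poissonRow X i ^ p‖ < 1) {a : ℝ} (ha : 0 < a)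
    (hD : (a : ℂ) • (1 : K →L[ℂ] K) ≤ defectMap X 1) : X ∈ openPolyball n K := by
  have hZ : 0 ≤ (a : ℂ) • (1 : K →L[ℂ] K) := ofReal_smul_nonneg ha.le zero_le_one
  refine ⟨hX, fun i => norm_poissonRow_lt_one_iff.1 ?_,
    (ContinuousLinearMap.nonneg_iff_isPositive _).1 (hZ.trans hD), isUnit_of_smul_one_le ha hD⟩
  -- The cap `1 / 2` keeps `1 - b` nonnegative, as the norm estimate requires.
  set b : ℝ := min a (1 / 2) with hb
  have hb0 : 0 < b := lt_min ha (by norm_num)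
  have hb1 : b ≤ 1 / 2 := min_le_right _ _
  have h1 : (b : ℂ) • (1 : K →L[ℂ] K) ≤ 1 - Phi (X i) 1 :=
    (ofReal_smul_mono (min_le_left _ _) zero_le_one).trans (le_one_sub_Phi hX h hZ hD i)
  have h2 : Phi (X i) 1 ≤ ((1 - b : ℝ) : ℂ) • (1 : K →L[ℂ] K) := by
    rw [Complex.ofReal_sub, sub_smul, Complex.ofReal_one, one_smul]
    exact le_sub_comm.1 h1
  have h3 := norm_le_of_nonneg_of_le_smul_one (by linarith) (Phi_nonneg (X i) zero_le_one) h2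
  have h4 := norm_poissonRow_pow_sq X i 1
  rw [pow_one, pow_one] at h4
  rw [← h4] at h3
  by_contra hcon
  push Not at hcon
  nlinarith

end Stripping

/-! ### Joint spectral radius through powers of `poissonRow`. -/

section SpectralRadius

theorem exists_tendsto_norm_pow_of_norm_pow_lt_one {𝒜 : Type*} [CStarAlgebra 𝒜] {T : 𝒜} {q : ℕ}
    (h : ‖T ^ (q + 1)‖ < 1) :
    ∃ ρ : ℝ, Filter.Tendsto (fun p : ℕ => ‖T ^ p‖ ^ (1 / (p : ℝ))) Filter.atTop (nhds ρ) ∧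
      ρ < 1 := by
  have hr : spectralRadius ℂ T < 1 := by
    rcases subsingleton_or_nontrivial 𝒜 with _ | _
    · simp
    refine (spectrum.spectralRadius_le_pow_nnnorm_pow_one_div ℂ T q).trans_lt ?_
    rw [nnnorm_one, ENNReal.coe_one, ENNReal.one_rpow, mul_one]
    refine ENNReal.rpow_lt_one ?_ (by positivity)
    exact_mod_cast h
  refine ⟨(spectralRadius ℂ T).toReal, ?_, ?_⟩
  · refine ((ENNReal.tendsto_toReal hr.ne_top).comp
      (spectrum.pow_norm_pow_one_div_tendsto_nhds_spectralRadius T)).congr fun p => ?_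
    exact ENNReal.toReal_ofReal (by positivity)
  · simpa using (ENNReal.toReal_lt_toReal hr.ne_top ENNReal.one_ne_top).2 hr

variable {K : Type*} [NormedAddCommGroup K] [InnerProductSpace ℂ K] [CompleteSpace K]
  {k : ℕ} {n : Fin k → ℕ}

theorem hasJointSpectralRadius_iff {X : OpTuple n K} {i : Fin k} {ρ : ℝ} :
    HasJointSpectralRadius (X i) ρ ↔
      Filter.Tendsto (fun p : ℕ => ‖poissonRow X i ^ p‖ ^ (1 / (p : ℝ))) Filter.atTop (nhds ρ) := by
  refine Filter.tendsto_congr fun p => ?_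
  rw [← Phi_pow_one, ← norm_poissonRow_pow_sq, ← Real.rpow_natCast,
    ← Real.rpow_mul (norm_nonneg (poissonRow X i ^ p))]
  congr 1
  push_cast
  -- At `p = 0` division by zero makes both exponents `0`.
  rcases eq_or_ne (p : ℝ) 0 with h | h
  · simp [h]
  · field_simp

/-- Gelfand's formula supplies the limit, and one power of norm below 1 already bounds it below 1.
Conversely a limit below 1 forces such a power. -/
theorem exists_hasJointSpectralRadius_lt_one_iff {X : OpTuple n K} {i : Fin k} :
    (∃ ρ : ℝ, HasJointSpectralRadius (X i) ρ ∧ ρ < 1) ↔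
      ∃ p, 1 ≤ p ∧ ‖poissonRow X i ^ p‖ < 1 := by
  simp only [hasJointSpectralRadius_iff]
  constructor
  · rintro ⟨ρ, h, h1⟩
    obtain ⟨p, hp, hlt⟩ := ((Filter.eventually_ge_atTop 1).and (h.eventually_lt_const h1)).exists
    refine ⟨p, hp, ?_⟩
    by_contra hcon
    push Not at hcon
    exact hlt.not_ge (Real.one_le_rpow hcon (by positivity))
  · rintro ⟨p, hp, hlt⟩
    obtain ⟨q, rfl⟩ : ∃ q, p = q + 1 := ⟨p - 1, by omega⟩
    exact exists_tendsto_norm_pow_of_norm_pow_lt_one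
      (𝒜 := HTensor (FockTensor n) K →L[ℂ] HTensor (FockTensor n) K) (T := poissonRow X i) hlt

end SpectralRadius

/-! ### Passing to the radial limit `r → 1`. -/

section CStarLimit

variable {𝒜 : Type*} [CStarAlgebra 𝒜]

theorem norm_ofReal_smul (c : ℝ) (x : 𝒜) : ‖(c : ℂ) • x‖ = |c| * ‖x‖ := by
  rw [norm_smul, Complex.norm_real, Real.norm_eq_abs]

theorem continuous_prod_one_sub_smul {k : ℕ} (T : Fin k → 𝒜) :
    Continuous fun r : ℝ => (List.ofFn fun i => 1 - (r : ℂ) • T i).prod := by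
  simp only [List.ofFn_eq_map]
  induction List.finRange k with
  | nil => exact continuous_const
  | cons i l ih =>
    simp only [List.map_cons, List.prod_cons]
    fun_prop

open scoped CStarAlgebra in
theorem smul_star_mul_self_le_of_forall_lt_one [PartialOrder 𝒜] [StarOrderedRing 𝒜] {ℬ : Type*}
    [CStarAlgebra ℬ] (φ : ℬ →⋆ₐ[ℂ] 𝒜) {k : ℕ} (T : Fin k → 𝒜) {D : ℝ → ℬ} (hD : Continuous D)
    (a : ℝ) (h : ∀ r : ℝ, 0 ≤ r → r < 1 →
      (a : ℂ) • (star (List.ofFn fun i => 1 - (r : ℂ) • T i).prod *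
        (List.ofFn fun i => 1 - (r : ℂ) • T i).prod) ≤ φ (D r)) :
    (a : ℂ) • (star (List.ofFn fun i => 1 - T i).prod * (List.ofFn fun i => 1 - T i).prod) ≤
      φ (D 1) := by
  have hc1 := continuous_prod_one_sub_smul T
  have hc2 : Continuous fun r : ℝ =>
      (a : ℂ) • (star (List.ofFn fun i => 1 - (r : ℂ) • T i).prod *
        (List.ofFn fun i => 1 - (r : ℂ) • T i).prod) := (hc1.star.mul hc1).const_smul _
  have hc3 : Continuous fun r => φ (D r) := (map_continuous φ).comp hD
  have ht1 := (hc2.tendsto 1).mono_left (nhdsWithin_le_nhds (s := Set.Iio 1))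
  have ht2 := (hc3.tendsto 1).mono_left (nhdsWithin_le_nhds (s := Set.Iio 1))
  simp only [Complex.ofReal_one, one_smul] at ht1
  refine le_of_tendsto_of_tendsto ht1 ht2 ?_
  filter_upwards [Ioo_mem_nhdsLT (zero_lt_one' ℝ)] with r hr
  exact h r hr.1.le hr.2

end CStarLimit

/-! ### From a lower bound on the kernel to membership in the open polyball. -/

section Radial

variable {K : Type*} [NormedAddCommGroup K] [InnerProductSpace ℂ K] [CompleteSpace K]
  {k : ℕ} {n : Fin k → ℕ}

theorem crossCommute_of_mem_closedPolyball {A : OpTuple n K} (hA : A ∈ closedPolyball n K) :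
    CrossCommute A := by
  have hc : IsClosed {X : OpTuple n K | CrossCommute X} := by
    simp only [CrossCommute, Set.ofPred_forall]
    exact isClosed_iInter fun s => isClosed_iInter fun t => isClosed_iInter fun _ =>
      isClosed_iInter fun a => isClosed_iInter fun b =>
        isClosed_eq (by fun_prop) (by fun_prop)
  exact closure_minimal (fun X hX => hX.1) hc hA

theorem norm_poissonRow_le_one_of_mem_closedPolyball {A : OpTuple n K}
    (hA : A ∈ closedPolyball n K) (i : Fin k) : ‖poissonRow A i‖ ≤ 1 := by
  have hc : IsClosed {X : OpTuple n K | ‖∑ j, X i j * star (X i j)‖ ≤ 1} :=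
    isClosed_le (by fun_prop) continuous_const
  have h : ‖∑ j, A i j * star (A i j)‖ ≤ 1 := by
    refine closure_minimal (fun X hX => ?_) hc hA
    have h2 := hX.2.1 i
    rw [Real.sqrt_lt' one_pos, one_pow] at h2
    exact h2.le
  rw [← norm_poissonRow_sq] at h
  exact (sq_le_one_iff₀ (norm_nonneg (poissonRow A i))).1 h

omit [CompleteSpace K] in
theorem CrossCommute.smul {X : OpTuple n K} (hX : CrossCommute X) (c : ℂ) :
    CrossCommute (c • X) := by
  intro s t h a b
  simp only [Pi.smul_apply, smul_mul_smul_comm, hX s t h a b]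

theorem poissonRow_smul (r : ℝ) (X : OpTuple n K) (i : Fin k) :
    poissonRow ((r : ℂ) • X) i = (r : ℂ) • poissonRow X i := by
  simp only [poissonRow, rowOp, Pi.smul_apply, star_smul, opTensor_smul_right, Complex.star_def,
    Complex.conj_ofReal, Finset.smul_sum]

theorem norm_poissonRow_smul_lt_one {A : OpTuple n K} {i : Fin k} (hA : ‖poissonRow A i‖ ≤ 1)
    {r : ℝ} (h0 : 0 ≤ r) (h1 : r < 1) : ‖poissonRow ((r : ℂ) • A) i‖ < 1 := by
  rw [poissonRow_smul,
    norm_ofReal_smul (𝒜 := HTensor (FockTensor n) K →L[ℂ] HTensor (FockTensor n) K),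
    abs_of_nonneg h0]
  nlinarith [norm_nonneg (poissonRow A i)]

theorem continuous_defectMap_one : Continuous fun X : OpTuple n K => defectMap X 1 := by
  simp only [defectMap, List.ofFn_eq_map]
  induction List.finRange k with
  | nil => exact continuous_const
  | cons i l ih =>
    simp only [List.map_cons, List.prod_cons, Module.End.mul_apply, LinearMap.sub_apply,
      Module.End.one_apply, Phi_apply]
    fun_prop

/-- The kernel series need not converge at `r = 1`, but after conjugation by the denominator both
sides of the inequality are continuous in `r`, so it survives the limit. -/
theorem mem_openPolyball_of_le_poissonKernel {A : OpTuple n K} (hA : A ∈ closedPolyball n K)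
    (h : ∀ i, ∃ p, 1 ≤ p ∧ ‖poissonRow A i ^ p‖ < 1) {a : ℝ} (ha : 0 < a)
    (hP : ∀ r : ℝ, 0 ≤ r → r < 1 →
      (a : ℂ) • (1 : HTensor (FockTensor n) K →L[ℂ] HTensor (FockTensor n) K) ≤
        poissonKernel ((r : ℂ) • A)) : A ∈ openPolyball n K := by
  have hX := crossCommute_of_mem_closedPolyball hA
  have h1 := norm_poissonRow_le_one_of_mem_closedPolyball hA
  -- At this stage `‖poissonRow A i‖ = 1` is not excluded, so invertibility comes from a power of
  -- norm below 1.
  obtain ⟨b, hb, hB⟩ := exists_smul_one_le_star_mul_self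
    (𝒜 := HTensor (FockTensor n) K →L[ℂ] HTensor (FockTensor n) K) (B := poissonDenom A)
    (isUnit_poissonDenom fun i => by
      obtain ⟨p, _, hp⟩ := h i
      exact isUnit_one_sub_of_norm_pow_lt_one
        (𝒜 := HTensor (FockTensor n) K →L[ℂ] HTensor (FockTensor n) K) hp)
  have hr : ∀ r : ℝ, 0 ≤ r → r < 1 →
      (a : ℂ) • (star (poissonDenom ((r : ℂ) • A)) * poissonDenom ((r : ℂ) • A)) ≤
        ampliation (FockTensor n) K (defectMap ((r : ℂ) • A) 1) := by
    intro r h0 hr1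
    rw [← conj_poissonKernel (hX.smul r) fun i => norm_poissonRow_smul_lt_one (h1 i) h0 hr1]
    have h2 := star_left_conjugate_le_conjugate
      (R := HTensor (FockTensor n) K →L[ℂ] HTensor (FockTensor n) K) (hP r h0 hr1)
      (poissonDenom ((r : ℂ) • A))
    rwa [mul_smul_comm, mul_one, smul_mul_assoc] at h2
  have hlim : (a : ℂ) • (star (poissonDenom A) * poissonDenom A) ≤
      ampliation (FockTensor n) K (defectMap A 1) := by
    have h3 := smul_star_mul_self_le_of_forall_lt_one
      (𝒜 := HTensor (FockTensor n) K →L[ℂ] HTensor (FockTensor n) K) (ampliation (FockTensor n) K)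
      (poissonRow A) (D := fun r : ℝ => defectMap ((r : ℂ) • A) 1)
      (continuous_defectMap_one.comp (by fun_prop)) a (fun r h0 hr1 => ?_)
    · simp only [Complex.ofReal_one, one_smul] at h3
      exact h3
    · have h4 := hr r h0 hr1
      simp only [poissonDenom, poissonRow_smul] at h4
      exact h4
  refine mem_openPolyball_of_smul_one_le hX h (mul_pos ha hb) ?_
  rw [← ampliation_le_iff (E := FockTensor n)]
  refine le_trans (le_of_eq ?_) ((ofReal_smul_le_smul
    (𝒜 := HTensor (FockTensor n) K →L[ℂ] HTensor (FockTensor n) K) ha.le hB).trans hlim)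
  rw [map_smul, map_one, smul_smul, Complex.ofReal_mul]

end Radial

/-! ### Bessel-type estimate for operators raising a grading. -/

section GradedEstimate

theorem prod_map_mulSingle {R ι : Type*} [Monoid R] [DecidableEq ι] {l : List ι} (hl : l.Nodup)
    (i : ι) (x : R) :
    (l.map fun j => (Pi.mulSingle i x : ι → R) j).prod = if i ∈ l then x else 1 := by
  induction l with
  | nil => simp
  | cons a l ih =>
    rw [List.nodup_cons] at hl
    rw [List.map_cons, List.prod_cons, ih hl.2]
    by_cases h : i = a
    · subst h
      simp [hl.1]
    · simp [h, Ne.symm h]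

section Graded

variable {G : Type*} [NormedAddCommGroup G] [InnerProductSpace ℂ G] [CompleteSpace G]
  {k : ℕ} {T : Fin k → G →L[ℂ] G} {V : (Fin k → ℕ) → Submodule ℂ G}

omit [CompleteSpace G] in
theorem pow_apply_mem_graded (hT : ∀ i q, ∀ x ∈ V q, T i x ∈ V (q + Pi.single i 1)) (i : Fin k)
    (p : ℕ) {q : Fin k → ℕ} {x : G} (hx : x ∈ V q) : (T i ^ p) x ∈ V (q + Pi.single i p) := by
  induction p with
  | zero => simpa using hx
  | succ p ih =>
    rw [pow_succ', mul_apply_eq_comp, Pi.single_add, ← add_assoc]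
    exact hT i _ _ ih

omit [CompleteSpace G] in
theorem prod_apply_mem_graded (hT : ∀ i q, ∀ x ∈ V q, T i x ∈ V (q + Pi.single i 1))
    (a : Fin k → ℕ) (l : List (Fin k)) {q : Fin k → ℕ} {x : G} (hx : x ∈ V q) :
    (l.map fun i => T i ^ a i).prod x ∈
      V (q + (l.map fun i => (Pi.single i (a i) : Fin k → ℕ)).sum) := by
  induction l with
  | nil => simpa using hx
  | cons i l ih =>
    simp only [List.map_cons, List.prod_cons, List.sum_cons, mul_apply_eq_comp]
    rw [add_comm (Pi.single i (a i) : Fin k → ℕ), ← add_assoc]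
    exact pow_apply_mem_graded hT i _ ih

theorem sum_map_single_finRange (a : Fin k → ℕ) :
    ((List.finRange k).map fun i => (Pi.single i (a i) : Fin k → ℕ)).sum = a := by
  rw [← List.ofFn_eq_map, List.sum_ofFn, Finset.univ_sum_single]

/-- Moving the adjoint powers onto `w` leaves vectors of degrees `q + m⁻` and `m⁺`, which agree only
when `m = q`. -/
theorem inner_poissonTerm_eq_zero (hT : ∀ i q, ∀ x ∈ V q, T i x ∈ V (q + Pi.single i 1))
    (hV : ∀ q q', q ≠ q' → ∀ x ∈ V q, ∀ y ∈ V q', inner ℂ x y = 0)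
    {q : Fin k → ℕ} {v w : G} (hv : v ∈ V 0) (hw : w ∈ V q) {m : Fin k → ℤ}
    (hm : m ≠ fun j => (q j : ℤ)) : inner ℂ w (poissonTerm T m v) = 0 := by
  have h1 : (List.ofFn fun i => star (T i) ^ (-(m i)).toNat).prod =
      star (((List.finRange k).reverse.map fun i => T i ^ (-(m i)).toNat).prod) := by
    rw [star_prod_map_reverse, List.ofFn_eq_map]
    simp only [star_pow]
  rw [poissonTerm, h1, mul_apply_eq_comp, ContinuousLinearMap.star_eq_adjoint,
    ContinuousLinearMap.adjoint_inner_right, List.ofFn_eq_map]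
  have h2 := prod_apply_mem_graded hT (fun i => (-(m i)).toNat) (List.finRange k).reverse hw
  have h3 := prod_apply_mem_graded hT (fun i => (m i).toNat) (List.finRange k) hv
  rw [List.map_reverse, List.sum_reverse, sum_map_single_finRange] at h2
  rw [sum_map_single_finRange] at h3
  refine hV _ _ (fun h => hm (funext fun j => ?_)) _ h2 _ h3
  have := congrFun h j
  simp only [Pi.add_apply, Pi.zero_apply] at this
  omega

theorem poissonTerm_single (i : Fin k) (p : ℕ) :
    poissonTerm T (fun j => ((Pi.single i p : Fin k → ℕ) j : ℤ)) = T i ^ p := by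
  have h1 : (fun j => T j ^ ((Pi.single i p : Fin k → ℕ) j : ℤ).toNat) =
      fun j => (Pi.mulSingle i (T i ^ p) : Fin k → G →L[ℂ] G) j := by
    funext j
    by_cases h : j = i
    · subst h; simp
    · simp [h]
  rw [poissonTerm, h1, List.ofFn_eq_map, List.ofFn_eq_map,
    prod_map_mulSingle (List.nodup_finRange k)]
  simp

/-- Applying the Poisson kernel to a vector of degree zero produces orthogonal components. -/
theorem sum_norm_pow_apply_sq_le (hT : ∀ i q, ∀ x ∈ V q, T i x ∈ V (q + Pi.single i 1))
    (hV : ∀ q q', q ≠ q' → ∀ x ∈ V q, ∀ y ∈ V q', inner ℂ x y = 0)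
    {P : G →L[ℂ] G} (hP : HasSum (poissonTerm T) P) {v : G} (hv : v ∈ V 0) (i : Fin k) (N : ℕ) :
    ∑ p ∈ Finset.range N, ‖(T i ^ p) v‖ ^ 2 ≤ (‖P‖ * ‖v‖) ^ 2 := by
  have hmem : ∀ p, (T i ^ p) v ∈ V (Pi.single i p) := fun p => by
    simpa using pow_apply_mem_graded hT i p hv
  have hin : ∀ p, inner ℂ ((T i ^ p) v) (P v) = inner ℂ ((T i ^ p) v) ((T i ^ p) v) := by
    intro p
    have h1 : HasSum (fun m => inner ℂ ((T i ^ p) v) (poissonTerm T m v))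
        (inner ℂ ((T i ^ p) v) (P v)) :=
      hP.mapL ((innerSL ℂ ((T i ^ p) v)).comp (ContinuousLinearMap.apply ℂ G v))
    have h2 := hasSum_single (f := fun m => inner ℂ ((T i ^ p) v) (poissonTerm T m v))
      (fun j => ((Pi.single i p : Fin k → ℕ) j : ℤ))
      fun m hm => inner_poissonTerm_eq_zero hT hV hv (hmem p) hm
    rw [h1.unique h2, poissonTerm_single]
  set w := ∑ p ∈ Finset.range N, (T i ^ p) v with hw
  set s := ∑ p ∈ Finset.range N, ‖(T i ^ p) v‖ ^ 2 with hs
  have hsw : ∑ p ∈ Finset.range N, inner ℂ ((T i ^ p) v) ((T i ^ p) v) = (s : ℂ) := by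
    rw [hs, Complex.ofReal_sum]
    exact Finset.sum_congr rfl fun p _ => by rw [inner_self_eq_norm_sq_to_K]; simp
  have hwP : inner ℂ w (P v) = (s : ℂ) := by
    rw [hw, sum_inner, ← hsw]
    exact Finset.sum_congr rfl fun p _ => hin p
  have hww : inner ℂ w w = (s : ℂ) := by
    rw [← hsw, hw, sum_inner]
    refine Finset.sum_congr rfl fun p hp => ?_
    rw [inner_sum, Finset.sum_eq_single p]
    · intro p' _ hne
      refine hV _ _ (fun h => hne ?_) _ (hmem p) _ (hmem p')
      simpa using (congrFun h i).symm
    · exact fun h => absurd hp h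
  have hnorm : ‖w‖ ^ 2 = s := by
    have := congrArg Complex.re hww
    rwa [inner_self_eq_norm_sq_to_K, Complex.ofReal_re, ← RCLike.ofReal_pow] at this
  -- Since `s = ‖w‖²` as well as `⟪w, P v⟫`, Cauchy–Schwarz bounds `‖w‖` by `‖P‖ ‖v‖`.
  have hle : s ≤ ‖w‖ * (‖P‖ * ‖v‖) := by
    have h1 := norm_inner_le_norm (𝕜 := ℂ) w (P v)
    rw [hwP, Complex.norm_real] at h1
    exact (le_abs_self s).trans (h1.trans
      (mul_le_mul_of_nonneg_left (P.le_opNorm v) (norm_nonneg w)))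
  rw [← hnorm] at hle ⊢
  have h3 : ‖w‖ ≤ ‖P‖ * ‖v‖ := by
    rcases (norm_nonneg w).eq_or_lt with h | h
    · rw [← h]; positivity
    · rw [sq] at hle
      exact le_of_mul_le_mul_left hle h
  exact pow_le_pow_left₀ (norm_nonneg w) h3 2

end Graded

end GradedEstimate

/-! ### Bounded Poisson kernel forces spectral radius below 1. -/

section FockGrading

variable {k : ℕ} (n : Fin k → ℕ) (K : Type*) [NormedAddCommGroup K] [InnerProductSpace ℂ K]

/-- The span of the vectors `e_α ⊗ h` with `|α_i| = q_i` for all `i`. -/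
def fockDegree (q : Fin k → ℕ) : Submodule ℂ (HTensor (FockTensor n) K) :=
  Submodule.span ℂ {z | ∃ (α : Words n) (h : K), (∀ i, (α i).length = q i) ∧
    ((fockBasis α ⊗ₜ[ℂ] h : FockTensor n ⊗[ℂ] K) : HTensor (FockTensor n) K) = z}

variable {n K}

theorem inner_fockDegree_eq_zero {q q' : Fin k → ℕ} (hq : q ≠ q')
    {x : HTensor (FockTensor n) K} (hx : x ∈ fockDegree n K q)
    {y : HTensor (FockTensor n) K} (hy : y ∈ fockDegree n K q') : inner ℂ x y = 0 := by
  have h : fockDegree n K q ⟂ fockDegree n K q' := by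
    rw [fockDegree, fockDegree, Submodule.isOrtho_span]
    rintro _ ⟨α, g, hα, rfl⟩ _ ⟨β, h, hβ, rfl⟩
    rw [UniformSpace.Completion.inner_coe, TensorProduct.inner_tmul, inner_fockBasis, if_neg,
      zero_mul]
    rintro rfl
    exact hq (funext fun i => (hα i).symm.trans (hβ i))
  exact (Submodule.isOrtho_iff_inner_eq.1 h) x hx y hy

variable [CompleteSpace K]

theorem poissonRow_mem_fockDegree (X : OpTuple n K) (i : Fin k) (q : Fin k → ℕ)
    (x : HTensor (FockTensor n) K) (hx : x ∈ fockDegree n K q) :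
    poissonRow X i x ∈ fockDegree n K (q + Pi.single i 1) := by
  suffices h : fockDegree n K q ≤ (fockDegree n K (q + Pi.single i 1)).comap
      (poissonRow X i).toLinearMap from h hx
  refine Submodule.span_le.2 ?_
  rintro _ ⟨α, h, hα, rfl⟩
  rw [SetLike.mem_coe, Submodule.mem_comap, ContinuousLinearMap.coe_coe, poissonRow, rowOp,
    sum_apply]
  refine Submodule.sum_mem _ fun j _ => ?_
  rw [opTensor_coe_tmul, rightCreation_fockBasis]
  refine Submodule.subset_span ⟨_, _, fun l => ?_, rfl⟩
  by_cases hl : l = i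
  · subst hl
    simp [appendLetter, hα]
  · simp [appendLetter, hl, hα]

theorem norm_pow_vacuum_sq (X : OpTuple n K) (i : Fin k) (p : ℕ) (h : K) :
    ((‖(poissonRow X i ^ p) ((fockBasis (fun _ => []) ⊗ₜ[ℂ] h : FockTensor n ⊗[ℂ] K) :
      HTensor (FockTensor n) K)‖ ^ 2 : ℝ) : ℂ) = inner ℂ ((Phi (X i) ^ p) 1 h) h := by
  have h1 := ampliation_Phi_pow (X i) (star_rightCreation_mul (n := n) i) p 1
  have h2 := inner_ampliation_tmul ((Phi (X i) ^ p) 1) (fockBasis (n := n) fun _ => [])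
    (fockBasis fun _ => []) h h
  rw [inner_fockBasis, if_pos rfl, one_mul, h1, map_one, mul_one, mul_apply_eq_comp,
    ContinuousLinearMap.star_eq_adjoint, ContinuousLinearMap.adjoint_inner_left] at h2
  rw [← h2, inner_self_eq_norm_sq_to_K]
  simp [poissonRow]

omit [CompleteSpace K] in
theorem norm_vacuum (h : K) : ‖((fockBasis (fun _ => []) ⊗ₜ[ℂ] h : FockTensor n ⊗[ℂ] K) :
      HTensor (FockTensor n) K)‖ = ‖h‖ := by
  rw [UniformSpace.Completion.norm_coe, TensorProduct.norm_tmul, orthonormal_fockBasis.1, one_mul]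

theorem hasSum_poissonKernel {X : OpTuple n K} (hX : CrossCommute X)
    (h1 : ∀ i, ‖poissonRow X i‖ < 1) : HasSum (poissonTerm (poissonRow X)) (poissonKernel X) := by
  have h := (summable_block_poissonCoeff hX h1).hasSum
  have h2 : (fun m => block poissonCoeff X m) = poissonTerm (poissonRow X) :=
    funext fun m => block_poissonCoeff X m
  rw [h2] at h
  rw [poissonKernel_eq]
  exact h

theorem sum_norm_pow_vacuum_le {X : OpTuple n K} (hX : CrossCommute X)
    (h1 : ∀ i, ‖poissonRow X i‖ < 1) {c : ℝ} (hc : ‖poissonKernel X‖ ≤ c) (i : Fin k) (N : ℕ)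
    (h : K) : ∑ p ∈ Finset.range N,
      ‖(poissonRow X i ^ p) ((fockBasis (fun _ => []) ⊗ₜ[ℂ] h : FockTensor n ⊗[ℂ] K) :
      HTensor (FockTensor n) K)‖ ^ 2 ≤ (c * ‖h‖) ^ 2 := by
  have hv : ((fockBasis (fun _ => []) ⊗ₜ[ℂ] h : FockTensor n ⊗[ℂ] K) : HTensor (FockTensor n) K) ∈
      fockDegree n K 0 := Submodule.subset_span ⟨_, _, fun _ => rfl, rfl⟩
  have h2 := sum_norm_pow_apply_sq_le (T := poissonRow X) (V := fockDegree n K)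
    (poissonRow_mem_fockDegree X) (fun q q' hq x hx y hy => inner_fockDegree_eq_zero hq hx hy)
    (hasSum_poissonKernel hX h1) hv i N
  rw [norm_vacuum] at h2
  refine h2.trans (pow_le_pow_left₀ (by positivity) ?_ 2)
  gcongr

/-- For a contraction the norms `‖T^p v‖` decrease in `p`, so each of the `N` terms of the square
sum at `rX` is at least `r^{2N} ‖T^N v‖²`; then `r → 1`. -/
theorem norm_pow_vacuum_le {X : OpTuple n K} (hX : CrossCommute X)
    (h1 : ∀ i, ‖poissonRow X i‖ ≤ 1) {c : ℝ}
    (hc : ∀ r : ℝ, 0 ≤ r → r < 1 → ‖poissonKernel ((r : ℂ) • X)‖ ≤ c) (i : Fin k) (N : ℕ)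
    (h : K) : N * ‖(poissonRow X i ^ N) ((fockBasis (fun _ => []) ⊗ₜ[ℂ] h : FockTensor n ⊗[ℂ] K) :
      HTensor (FockTensor n) K)‖ ^ 2 ≤ (c * ‖h‖) ^ 2 := by
  set v : HTensor (FockTensor n) K :=
    ((fockBasis (fun _ => []) ⊗ₜ[ℂ] h : FockTensor n ⊗[ℂ] K) : HTensor (FockTensor n) K) with hv
  have hanti : ∀ p ≤ N, ‖(poissonRow X i ^ N) v‖ ≤ ‖(poissonRow X i ^ p) v‖ := by
    intro p hp
    obtain ⟨q, rfl⟩ := Nat.exists_eq_add_of_le' hp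
    rw [pow_add, mul_apply_eq_comp]
    refine ((poissonRow X i ^ q).le_opNorm _).trans ?_
    refine mul_le_of_le_one_left (norm_nonneg ((poissonRow X i ^ p) v)) ?_
    rcases q with _ | q
    · rw [pow_zero]; exact ContinuousLinearMap.norm_id_le
    · exact (norm_pow_le' (poissonRow X i) q.succ_pos).trans
        (pow_le_one₀ (norm_nonneg (poissonRow X i)) (h1 i))
  have key : ∀ r : ℝ, 0 ≤ r → r < 1 →
      r ^ (2 * N) * (N * ‖(poissonRow X i ^ N) v‖ ^ 2) ≤ (c * ‖h‖) ^ 2 := by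
    intro r h0 hr
    refine le_trans ?_ (sum_norm_pow_vacuum_le (hX.smul r)
      (fun j => norm_poissonRow_smul_lt_one (h1 j) h0 hr) (hc r h0 hr) i N h)
    rw [← hv]
    have h3 : ∑ _p ∈ Finset.range N, r ^ (2 * N) * ‖(poissonRow X i ^ N) v‖ ^ 2 =
        r ^ (2 * N) * (N * ‖(poissonRow X i ^ N) v‖ ^ 2) := by
      rw [Finset.sum_const, Finset.card_range, nsmul_eq_mul]; ring
    rw [← h3]
    refine Finset.sum_le_sum fun p hp => ?_
    have hpN := (Finset.mem_range.1 hp).le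
    have h4 : ‖(poissonRow ((r : ℂ) • X) i ^ p) v‖ = r ^ p * ‖(poissonRow X i ^ p) v‖ := by
      rw [poissonRow_smul, smul_pow, smul_apply, norm_smul, norm_pow,
        Complex.norm_real, Real.norm_of_nonneg h0]
    rw [h4, mul_pow, ← pow_mul, mul_comm p 2]
    have h5 : r ^ (2 * N) ≤ r ^ (2 * p) := pow_le_pow_of_le_one h0 hr.le (by omega)
    have h6 := hanti p hpN
    gcongr
  have hcont : Continuous fun r : ℝ => r ^ (2 * N) * (N * ‖(poissonRow X i ^ N) v‖ ^ 2) := by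
    fun_prop
  have ht := (hcont.tendsto 1).mono_left (nhdsWithin_le_nhds (s := Set.Iio 1))
  rw [one_pow, one_mul] at ht
  refine le_of_tendsto ht ?_
  filter_upwards [Ioo_mem_nhdsLT (zero_lt_one' ℝ)] with r hr
  exact key r hr.1.le hr.2

open scoped ComplexOrder in
theorem exists_norm_poissonRow_pow_lt_one {X : OpTuple n K} (hX : CrossCommute X)
    (h1 : ∀ i, ‖poissonRow X i‖ ≤ 1) {c : ℝ}
    (hc : ∀ r : ℝ, 0 ≤ r → r < 1 → ‖poissonKernel ((r : ℂ) • X)‖ ≤ c) (i : Fin k) :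
    ∃ p, 1 ≤ p ∧ ‖poissonRow X i ^ p‖ < 1 := by
  -- The vacuum estimate reads `Φ^N(I) ≤ (c²/N) I`, so any `N > c²` works.
  obtain ⟨N, hN⟩ := exists_nat_gt (c ^ 2)
  have hN0 : (0 : ℝ) < N := (sq_nonneg c).trans_lt hN
  refine ⟨N, by exact_mod_cast hN0, ?_⟩
  have h2 : (Phi (X i) ^ N) 1 ≤ ((c ^ 2 / N : ℝ) : ℂ) • (1 : K →L[ℂ] K) := by
    rw [← sub_nonneg, nonneg_iff_inner_nonneg]
    intro h
    have h3 := norm_pow_vacuum_le hX h1 hc i N h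
    rw [sub_apply, inner_sub_left, ← norm_pow_vacuum_sq,
      smul_apply, inner_smul_left, Complex.conj_ofReal, one_apply_eq_self,
      show inner ℂ h h = ((‖h‖ ^ 2 : ℝ) : ℂ) by simp [inner_self_eq_norm_sq_to_K]]
    have h4 : ‖(poissonRow X i ^ N) ((fockBasis (fun _ => []) ⊗ₜ[ℂ] h : FockTensor n ⊗[ℂ] K) :
        HTensor (FockTensor n) K)‖ ^ 2 ≤ c ^ 2 / N * ‖h‖ ^ 2 := by
      rw [div_mul_eq_mul_div, le_div_iff₀ hN0]
      nlinarith
    rw [sub_nonneg]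
    rw [← Complex.ofReal_mul]
    exact Complex.real_le_real.2 h4
  have h3 := norm_le_of_nonneg_of_le_smul_one (by positivity)
    (Phi_pow_nonneg (X i) N zero_le_one) h2
  rw [← norm_poissonRow_pow_sq] at h3
  have h4 : c ^ 2 / N < 1 := (div_lt_one hN0).2 hN
  by_contra hcon
  push Not at hcon
  nlinarith

end FockGrading

/-! ### Operator-valued Harnack inequality on the torus. -/

section OperatorHarnack

variable {G : Type*} [NormedAddCommGroup G] [InnerProductSpace ℂ G]

open scoped ComplexOrder in
theorem nonneg_iff_inner_right_nonneg {Y : G →L[ℂ] G} : 0 ≤ Y ↔ ∀ x, 0 ≤ inner ℂ x (Y x) := by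
  rw [nonneg_iff_inner_nonneg]
  refine forall_congr' fun x => ?_
  rw [← inner_conj_symm x (Y x), ← Complex.star_def, star_nonneg_iff]

variable [CompleteSpace G]

open scoped ComplexOrder in
theorem le_iff_inner_right_le {Y Z : G →L[ℂ] G} :
    Y ≤ Z ↔ ∀ x, inner ℂ x (Y x) ≤ inner ℂ x (Z x) := by
  rw [← sub_nonneg, nonneg_iff_inner_right_nonneg]
  simp only [sub_apply, inner_sub_right, sub_nonneg]

omit [CompleteSpace G] in
theorem inner_tsum_apply {ι : Type*} {b : ι → G →L[ℂ] G} (hb : Summable b) (x : G) :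
    inner ℂ x ((∑' m, b m) x) = ∑' m, inner ℂ x (b m x) :=
  ((innerSL ℂ x).comp (ContinuousLinearMap.apply ℂ G x)).map_tsum hb

theorem inner_tsum_smul_apply {ι : Type*} {b : ι → G →L[ℂ] G} (hb : Summable fun m => ‖b m‖)
    {w : ι → ℂ} (hw : ∀ m, ‖w m‖ ≤ 1) (x : G) :
    inner ℂ x ((∑' m, w m • b m) x) = ∑' m, w m * inner ℂ x (b m x) := by
  rw [inner_tsum_apply]
  · simp only [smul_apply, inner_smul_right]
  · refine Summable.of_norm_bounded hb fun m => ?_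
    rw [norm_smul]
    exact mul_le_of_le_one_left (norm_nonneg _) (hw m)

/-- Reduces to the scalar case for the coefficients `⟪x, b m x⟫`, one vector `x` at a time. -/
theorem torus_harnack_operator {k : ℕ} {ρ : ℝ} (h0 : 0 ≤ ρ) (h1 : ρ < 1)
    {b : (Fin k → ℤ) → G →L[ℂ] G} (hb : Summable fun m => ‖b m‖)
    (hpos : ∀ θ : Fin k → UnitAddCircle, 0 ≤ ∑' m, (∏ i, fourier (m i) (θ i)) • b m) :
    0 ≤ b 0 ∧
      (((((1 + ρ) / (1 - ρ)) ^ k)⁻¹ : ℝ) : ℂ) • b 0 ≤ ∑' m, (∏ i, (ρ : ℂ) ^ (m i).natAbs) • b m ∧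
      ∑' m, (∏ i, (ρ : ℂ) ^ (m i).natAbs) • b m ≤ (((((1 + ρ) / (1 - ρ)) ^ k : ℝ)) : ℂ) • b 0 := by
  have hw : ∀ m : Fin k → ℤ, ‖∏ i, (ρ : ℂ) ^ (m i).natAbs‖ ≤ 1 := fun m => by
    rw [norm_prod]
    refine Finset.prod_le_one (fun _ _ => norm_nonneg _) fun i _ => ?_
    rw [norm_pow, Complex.norm_real, Real.norm_of_nonneg h0]
    exact pow_le_one₀ h0 h1.le
  have hf : ∀ (θ : Fin k → UnitAddCircle) (m : Fin k → ℤ),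
      ‖∏ i, fourier (m i) (θ i)‖ ≤ 1 := fun θ m => by
    rw [norm_prod]
    exact Finset.prod_le_one (fun _ _ => norm_nonneg _) fun i _ => (norm_fourier_apply _ _).le
  have key := fun x : G => torus_harnack_complex h0 h1 (fun m => inner ℂ x (b m x))
    (Summable.of_nonneg_of_le (fun _ => norm_nonneg _) (fun m => (norm_inner_le_norm _ _).trans
      ((mul_le_mul_of_nonneg_left ((b m).le_opNorm x) (norm_nonneg x)).trans_eq
        (show _ = ‖b m‖ * (‖x‖ * ‖x‖) by ring))) (hb.mul_right _))
    (fun θ => by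
      have h := nonneg_iff_inner_right_nonneg.1 (hpos θ) x
      rw [inner_tsum_smul_apply hb (hf θ)] at h
      simpa only [mul_comm] using h)
  refine ⟨nonneg_iff_inner_right_nonneg.2 fun x => (key x).1,
    le_iff_inner_right_le.2 fun x => ?_, le_iff_inner_right_le.2 fun x => ?_⟩
  · rw [inner_tsum_smul_apply hb hw, smul_apply, inner_smul_right]
    exact (key x).2.1
  · rw [inner_tsum_smul_apply hb hw, smul_apply, inner_smul_right]
    exact (key x).2.2

end OperatorHarnack

/-! ### Blocks under scaling and rotation of each tuple. -/

section Scaling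

variable {k : ℕ} {n : Fin k → ℕ} {K : Type*} [NormedAddCommGroup K] [InnerProductSpace ℂ K]

theorem list_prod_smul {ι 𝒜 : Type*} [Semiring 𝒜] [Algebra ℂ 𝒜] (l : List ι) (c : ι → ℂ)
    (S : ι → 𝒜) : (l.map fun i => c i • S i).prod = (l.map c).prod • (l.map S).prod := by
  induction l with
  | nil => simp
  | cons a l ih => simp only [List.map_cons, List.prod_cons, ih, smul_mul_smul_comm]

/-- The tuple `(z_1 X_1, …, z_k X_k)`. -/
def gauge (z : Fin k → ℂ) (X : OpTuple n K) : OpTuple n K := fun i j => z i • X i j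

theorem smul_eq_gauge (c : ℂ) (X : OpTuple n K) : c • X = gauge (fun _ => c) X := rfl

theorem wordOp_smul {m : ℕ} (c : ℂ) (T : Fin m → K →L[ℂ] K) (α : List (Fin m)) :
    wordOp (fun j => c • T j) α = c ^ α.length • wordOp T α := by
  rw [wordOp, list_prod_smul, wordOp]
  simp

theorem wordOp_gauge (z : Fin k → ℂ) (X : OpTuple n K) (i : Fin k) (α : List (Fin (n i))) :
    wordOp (gauge z X i) α = z i ^ α.length • wordOp (X i) α :=
  wordOp_smul (z i) (X i) α

theorem multiWordOp_gauge (z : Fin k → ℂ) (X : OpTuple n K) (α : Words n) :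
    multiWordOp (gauge z X) α = (∏ i, z i ^ (α i).length) • multiWordOp X α := by
  simp only [multiWordOp, wordOp_gauge, List.ofFn_eq_map, list_prod_smul]
  rw [← List.ofFn_eq_map, List.prod_ofFn]

variable [CompleteSpace K]

theorem multiWordOpStar_gauge (z : Fin k → ℂ) (X : OpTuple n K) (β : Words n) :
    multiWordOpStar (gauge z X) β = (∏ i, star (z i) ^ (β i).length) • multiWordOpStar X β := by
  simp only [multiWordOpStar, wordOp_gauge, List.ofFn_eq_map, star_smul, list_prod_smul,
    star_pow]
  rw [← List.ofFn_eq_map, List.prod_ofFn]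

variable {E : Type*} [NormedAddCommGroup E] [InnerProductSpace ℂ E]

theorem block_gauge (C : Words n → Words n → (E →L[ℂ] E)) (z : Fin k → ℂ) (X : OpTuple n K)
    (m : Fin k → ℤ) : block C (gauge z X) m =
      (∏ i, z i ^ (-(m i)).toNat * star (z i) ^ (m i).toNat) • block C X m := by
  simp only [block, multiWordOp_gauge, multiWordOpStar_gauge, smul_mul_smul_comm,
    opTensor_smul_right, List.length_ofFn, Finset.smul_sum, Finset.prod_mul_distrib]

theorem block_smul_ofReal (C : Words n → Words n → (E →L[ℂ] E)) (r : ℝ) (X : OpTuple n K)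
    (m : Fin k → ℤ) : block C ((r : ℂ) • X) m = (∏ i, (r : ℂ) ^ (m i).natAbs) • block C X m := by
  rw [smul_eq_gauge, block_gauge]
  congr 1
  refine Finset.prod_congr rfl fun i _ => ?_
  rw [Complex.star_def, Complex.conj_ofReal, ← pow_add]
  congr 1
  omega

/-- Positive degrees sit on the adjoints, which conjugate the phase; hence the frequency `-1` in the
rotation. -/
theorem block_gauge_fourier (C : Words n → Words n → (E →L[ℂ] E)) (θ : Fin k → UnitAddCircle)
    (X : OpTuple n K) (m : Fin k → ℤ) :
    block C (gauge (fun i => fourier (-1) (θ i)) X) m =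
      (∏ i, fourier (m i) (θ i)) • block C X m := by
  rw [block_gauge]
  congr 1
  refine Finset.prod_congr rfl fun i _ => ?_
  have hpow : ∀ (a : ℤ) (p : ℕ), (fourier a (θ i) : ℂ) ^ p = fourier (p * a) (θ i) := by
    intro a p
    induction p with
    | zero => rw [pow_zero, Nat.cast_zero, zero_mul, fourier_zero]
    | succ p ih => rw [pow_succ, ih, ← fourier_add]; congr 2; push_cast; ring
  rw [Complex.star_def, ← fourier_neg, hpow, hpow, ← fourier_add]
  congr 2
  omega

/-- The block of degree 0 involves only empty words, so `X` may be any tuple convenient to the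
caller. -/
theorem evalAt_zero (C : Words n → Words n → (E →L[ℂ] E)) (X : OpTuple n K) :
    evalAt C (0 : OpTuple n K) = block C X 0 := by
  have h : (0 : OpTuple n K) = ((0 : ℝ) : ℂ) • X := by simp
  rw [evalAt, tsum_eq_single 0]
  · rw [h, block_smul_ofReal]; simp
  · intro m hm
    obtain ⟨i, hi⟩ := Function.ne_iff.1 hm
    rw [h, block_smul_ofReal, Finset.prod_eq_zero (Finset.mem_univ i), zero_smul]
    rw [Complex.ofReal_zero, zero_pow]
    simpa using hi

end Scaling

/-! ### Stability of the open polyball under rotations and slight dilations. -/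

section NeighbourhoodOfOne

theorem eventually_smul_one_le {𝒜 : Type*} [CStarAlgebra 𝒜] [PartialOrder 𝒜] [StarOrderedRing 𝒜]
    {α : Type*} {l : Filter α} {D : α → 𝒜} {x : 𝒜} {b c : ℝ} (hcb : c < b)
    (hx : (b : ℂ) • (1 : 𝒜) ≤ x) (hD : Filter.Tendsto D l (nhds x))
    (hsa : ∀ s, IsSelfAdjoint (D s - x)) : ∀ᶠ s in l, (c : ℂ) • (1 : 𝒜) ≤ D s := by
  have h := (tendsto_iff_norm_sub_tendsto_zero.1 hD).eventually_le_const (sub_pos.2 hcb)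
  filter_upwards [h] with s hs
  have h1 := (hsa s).neg_algebraMap_norm_le_self
  rw [IsScalarTower.algebraMap_apply ℝ ℂ 𝒜, Algebra.algebraMap_eq_smul_one] at h1
  have h2 : ((c - b : ℝ) : ℂ) • (1 : 𝒜) ≤ D s - x := by
    refine le_trans ?_ h1
    change _ ≤ -(((‖D s - x‖ : ℝ) : ℂ) • (1 : 𝒜))
    rw [← neg_smul, ← Complex.ofReal_neg]
    exact ofReal_smul_mono (by linarith) zero_le_one
  have h3 := add_le_add h2 hx
  rwa [sub_add_cancel, ← add_smul, ← Complex.ofReal_add, sub_add_cancel] at h3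

variable {K : Type*} [NormedAddCommGroup K] [InnerProductSpace ℂ K] [CompleteSpace K]
  {k : ℕ} {n : Fin k → ℕ}

theorem isSelfAdjoint_defectMap_one (X : OpTuple n K) : IsSelfAdjoint (defectMap X 1) := by
  simp only [defectMap, List.ofFn_eq_map]
  induction List.finRange k with
  | nil => exact IsSelfAdjoint.one _
  | cons i l ih =>
    simp only [List.map_cons, List.prod_cons, Module.End.mul_apply, LinearMap.sub_apply,
      Module.End.one_apply, Phi_apply]
    refine ih.sub (isSelfAdjoint_sum _ fun j _ => ?_)
    exact ih.conjugate _

theorem Phi_smul {m : ℕ} {z : ℂ} (hz : ‖z‖ = 1) (T : Fin m → K →L[ℂ] K) :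
    Phi (fun j => z • T j) = Phi T := by
  ext1 Y
  simp only [Phi_apply, star_smul, smul_mul_assoc, mul_smul_comm, smul_smul]
  simp [Complex.mul_conj, Complex.normSq_eq_norm_sq, hz, mul_comm]

/-- Unimodular phases cancel in every `Φ_i`, so the defect and the row norms do not change. -/
theorem gauge_mem_openPolyball {X : OpTuple n K} (hX : X ∈ openPolyball n K) {z : Fin k → ℂ}
    (hz : ∀ i, ‖z i‖ = 1) : gauge z X ∈ openPolyball n K := by
  have h1 : ∀ i, Phi (gauge z X i) = Phi (X i) := fun i => Phi_smul (hz i) (X i)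
  have h2 : defectMap (gauge z X) = defectMap X := by simp only [defectMap, h1]
  refine ⟨fun s t hst a b => ?_, fun i => ?_, by rw [h2]; exact hX.2.2⟩
  · simp only [gauge, smul_mul_smul_comm, hX.1 s t hst a b, mul_comm]
  · have h3 := congrArg (fun φ => φ 1) (h1 i)
    simp only [Phi_apply, mul_one] at h3
    rw [h3]
    exact hX.2.1 i

theorem eventually_smul_mem_openPolyball {X : OpTuple n K} (hX : X ∈ openPolyball n K) :
    ∀ᶠ s : ℝ in nhds 1, (s : ℂ) • X ∈ openPolyball n K := by
  have hs : Continuous fun s : ℝ => (s : ℂ) • X := by fun_prop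
  have hx1 : ((1 : ℝ) : ℂ) • X = X := by rw [Complex.ofReal_one, one_smul]
  obtain ⟨b, hb, hle⟩ := exists_smul_one_le_of_isUnit
    ((ContinuousLinearMap.nonneg_iff_isPositive _).2 hX.2.2.1) hX.2.2.2
  have h1 : ∀ᶠ s : ℝ in nhds 1, ∀ i,
      Real.sqrt ‖∑ j, ((s : ℂ) • X) i j * star (((s : ℂ) • X) i j)‖ < 1 := by
    rw [Filter.eventually_all]
    intro i
    have hc : Continuous fun Y : OpTuple n K => Real.sqrt ‖∑ j, Y i j * star (Y i j)‖ := by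
      fun_prop
    have ht := (hc.comp hs).tendsto 1
    refine ht.eventually_lt_const ?_
    simp only [Function.comp_apply, hx1]
    exact hX.2.1 i
  have ht := (continuous_defectMap_one.comp hs).tendsto 1
  simp only [Function.comp_apply, hx1] at ht
  have h2 := eventually_smul_one_le (half_lt_self hb) hle ht fun s =>
    (isSelfAdjoint_defectMap_one _).sub (isSelfAdjoint_defectMap_one _)
  filter_upwards [h1, h2] with s hs1 hs2
  refine ⟨CrossCommute.smul hX.1 _, hs1, (ContinuousLinearMap.nonneg_iff_isPositive _).1 ?_,
    isUnit_of_smul_one_le (half_pos hb) hs2⟩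
  exact (ofReal_smul_nonneg (half_pos hb).le zero_le_one).trans hs2

/-- Two dilations are needed: convergence at `t` makes the series at `s < t` absolutely convergent,
and `s > 1` keeps `r / s` away from 1. -/
theorem exists_smul_mem_openPolyball {X : OpTuple n K} (hX : X ∈ openPolyball n K) :
    ∃ s t : ℝ, 1 < s ∧ s < t ∧ (s : ℂ) • X ∈ openPolyball n K ∧ (t : ℂ) • X ∈ openPolyball n K := by
  obtain ⟨ε, hε, h⟩ := Metric.eventually_nhds_iff.1 (eventually_smul_mem_openPolyball hX)
  refine ⟨1 + ε / 3, 1 + ε / 2, by linarith, by linarith, h ?_, h ?_⟩ <;>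
  · rw [Real.dist_eq, add_sub_cancel_left, abs_of_pos (by positivity)]
    linarith

end NeighbourhoodOfOne

/-! ### Harnack equivalence with `0` on the open polyball, and bounds from Poisson equivalence. -/

section Harnack

variable {k : ℕ} {n : Fin k → ℕ}

/-- Unordered convergence need not be absolute in infinite dimension, but its terms tend to 0. Their
norms are thus at most 1 off a finite set, and the geometric weights dominate. -/
theorem Summable.norm_prod_pow_smul {G : Type*} [NormedAddCommGroup G] [InnerProductSpace ℂ G]
    {b : (Fin k → ℤ) → G →L[ℂ] G} (hb : Summable b) {r : ℝ} (h0 : 0 ≤ r) (h1 : r < 1) :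
    Summable fun m : Fin k → ℤ => ‖(∏ i, (r : ℂ) ^ (m i).natAbs) • b m‖ := by
  have h2 := (tendsto_zero_iff_norm_tendsto_zero.1 hb.tendsto_cofinite_zero).eventually_le_const
    one_pos
  refine Summable.of_norm_bounded_eventually
    (summable_prod_pow_natAbs (k := k) (ρ := fun _ => r) (fun _ => h0) fun _ => h1) ?_
  filter_upwards [h2] with m hm
  rw [norm_norm, norm_smul, norm_prod]
  simp only [norm_pow, Complex.norm_real, Real.norm_of_nonneg h0]
  exact mul_le_of_le_one_right (Finset.prod_nonneg fun _ _ => pow_nonneg h0 _) hm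

theorem evalAt_harnack {H : Type u} [NormedAddCommGroup H] [InnerProductSpace ℂ H]
    [CompleteSpace H] {E : Type*} [NormedAddCommGroup E] [InnerProductSpace ℂ E]
    {C : Words n → Words n → (E →L[ℂ] E)} (hC : IsFreePluriharmonic.{u} C)
    (hpos : IsPositiveOnPolyball.{u} C) {A : OpTuple n H} {s t : ℝ} (hs : 0 < s) (hst : s < t)
    (hsA : (s : ℂ) • A ∈ openPolyball n H) (htA : (t : ℂ) • A ∈ openPolyball n H)
    {r : ℝ} (h0 : 0 ≤ r) (hrs : r < s) :
    0 ≤ evalAt C (0 : OpTuple n H) ∧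
      (((((1 + r / s) / (1 - r / s)) ^ k)⁻¹ : ℝ) : ℂ) • evalAt C (0 : OpTuple n H) ≤
        evalAt C ((r : ℂ) • A) ∧
      evalAt C ((r : ℂ) • A) ≤
        ((((1 + r / s) / (1 - r / s)) ^ k : ℝ) : ℂ) • evalAt C (0 : OpTuple n H) := by
  have ht : 0 < t := hs.trans hst
  have hscale : ∀ {x y : ℝ}, y ≠ 0 → ((x / y : ℝ) : ℂ) • (y : ℂ) • A = (x : ℂ) • A := by
    intro x y hy
    rw [smul_smul, ← Complex.ofReal_mul, div_mul_cancel₀ _ hy]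
  have hb : Summable fun m => ‖block C ((s : ℂ) • A) m‖ := by
    have h := Summable.norm_prod_pow_smul (hC H _ htA) (div_nonneg hs.le ht.le)
      ((div_lt_one ht).2 hst)
    simp only [← block_smul_ofReal, hscale ht.ne'] at h
    exact h
  have h := torus_harnack_operator (div_nonneg h0 hs.le) ((div_lt_one hs).2 hrs) hb fun θ => by
    simp only [← block_gauge_fourier]
    exact (ContinuousLinearMap.nonneg_iff_isPositive _).2
      (hpos H _ (gauge_mem_openPolyball hsA fun i => norm_fourier_apply _ _))
  simp only [← block_smul_ofReal, hscale hs.ne'] at h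
  rw [evalAt_zero C ((s : ℂ) • A)]
  exact h

theorem harnackEquiv_zero_of_mem_openPolyball {H : Type u} [NormedAddCommGroup H]
    [InnerProductSpace ℂ H] [CompleteSpace H] {A : OpTuple n H} (hA : A ∈ openPolyball n H) :
    HarnackEquiv A 0 := by
  obtain ⟨s, t, hs1, hst, hsA, htA⟩ := exists_smul_mem_openPolyball hA
  have hs : 0 < s := one_pos.trans hs1
  -- The Harnack constant at `r = 1` bounds those for all `r < 1`. Domination is stated with `c²`,
  -- hence `c = √κ`.
  set κ : ℝ := ((1 + 1 / s) / (1 - 1 / s)) ^ k with hκ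
  have hd : 0 < 1 - 1 / s := by rw [sub_pos, div_lt_one hs]; exact hs1
  have hκ0 : 0 < κ := by positivity
  have hmono : ∀ r : ℝ, 0 ≤ r → r < 1 →
      0 < ((1 + r / s) / (1 - r / s)) ^ k ∧ ((1 + r / s) / (1 - r / s)) ^ k ≤ κ := by
    intro r h0 h1
    have h2 : r / s ≤ 1 / s := by gcongr
    have h3 : 0 < 1 - r / s := by linarith
    refine ⟨by positivity, ?_⟩
    rw [hκ]
    gcongr
  have hsq : ((Real.sqrt κ : ℝ) : ℂ) ^ 2 = ((κ : ℝ) : ℂ) := by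
    rw [← Complex.ofReal_pow, Real.sq_sqrt hκ0.le]
  refine ⟨⟨Real.sqrt κ, Real.sqrt_pos.2 hκ0, ?_⟩, ⟨Real.sqrt κ, Real.sqrt_pos.2 hκ0, ?_⟩⟩
  all_goals
    intro E _ _ _ _ C hC hpos r h0 h1
    obtain ⟨hp, hl, hu⟩ := evalAt_harnack hC hpos hs hst hsA htA h0 (h1.trans hs1)
    obtain ⟨hm0, hm⟩ := hmono r h0 h1
    rw [hsq, smul_zero]
  · exact hu.trans (ofReal_smul_mono (𝒜 := HTensor E H →L[ℂ] HTensor E H) hm hp)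
  · have h2 := ofReal_smul_le_smul (𝒜 := HTensor E H →L[ℂ] HTensor E H) hm0.le hl
    rw [smul_smul, ← Complex.ofReal_mul, mul_inv_cancel₀ hm0.ne', Complex.ofReal_one,
      one_smul] at h2
    refine h2.trans (ofReal_smul_mono (𝒜 := HTensor E H →L[ℂ] HTensor E H) hm ?_)
    exact (ofReal_smul_nonneg (𝒜 := HTensor E H →L[ℂ] HTensor E H)
      (inv_nonneg.2 hm0.le) hp).trans hl

theorem poissonKernel_zero {K : Type*} [NormedAddCommGroup K] [InnerProductSpace ℂ K]
    [CompleteSpace K] : poissonKernel (0 : OpTuple n K) = 1 := by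
  have hrow : ∀ i, poissonRow (0 : OpTuple n K) i = 0 := fun i => by
    have h := poissonRow_smul (n := n) (K := K) 0 0 i
    simpa using h
  have hden : poissonDenom (0 : OpTuple n K) = 1 := by
    simp [poissonDenom, hrow, List.ofFn_const]
  have hΦ : ∀ i, Phi ((0 : OpTuple n K) i) = 0 := fun i => by
    ext1 Y; simp [Phi_apply]
  have hdef : defectMap (0 : OpTuple n K) 1 = 1 := by
    simp only [defectMap, hΦ, sub_zero, List.ofFn_const, List.prod_replicate, one_pow,
      Module.End.one_apply]
  have h := conj_poissonKernel (X := (0 : OpTuple n K)) (fun s t _ a b => by simp)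
    fun i => by
      rw [hrow, norm_zero (E := HTensor (FockTensor n) K →L[ℂ] HTensor (FockTensor n) K)]
      exact one_pos
  rwa [hden, hdef, map_one, hTensor_star_one, one_mul, mul_one] at h

theorem PoissonEquiv.mem_openPolyball_conditions {H : Type*} [NormedAddCommGroup H]
    [InnerProductSpace ℂ H] [CompleteSpace H] {A : OpTuple n H} (hA : A ∈ closedPolyball n H)
    (h : PoissonEquiv A 0) :
    (∀ i, ∃ p, 1 ≤ p ∧ ‖poissonRow A i ^ p‖ < 1) ∧
      ∃ a : ℝ, 0 < a ∧ ∀ r : ℝ, 0 ≤ r → r < 1 →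
        (a : ℂ) • (1 : HTensor (FockTensor n) H →L[ℂ] HTensor (FockTensor n) H) ≤
          poissonKernel ((r : ℂ) • A) := by
  obtain ⟨⟨c, hc, hAc⟩, d, hd, hdA⟩ := h
  simp only [smul_zero, poissonKernel_zero, ← Complex.ofReal_pow] at hAc hdA
  -- Since `P(R, 0) = I`, domination of `0` by `A` is a lower bound on the kernel, and domination of
  -- `A` by `0` is an upper bound.
  have hlow : ∀ r : ℝ, 0 ≤ r → r < 1 → (((d ^ 2)⁻¹ : ℝ) : ℂ) •
      (1 : HTensor (FockTensor n) H →L[ℂ] HTensor (FockTensor n) H) ≤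
        poissonKernel ((r : ℂ) • A) := by
    intro r h0 h1
    have h2 := ofReal_smul_le_smul
      (𝒜 := HTensor (FockTensor n) H →L[ℂ] HTensor (FockTensor n) H)
      (inv_nonneg.2 (sq_nonneg d)) (hdA r h0 h1)
    rwa [smul_smul, ← Complex.ofReal_mul, inv_mul_cancel₀ (by positivity), Complex.ofReal_one,
      one_smul] at h2
  refine ⟨exists_norm_poissonRow_pow_lt_one (crossCommute_of_mem_closedPolyball hA)
    (norm_poissonRow_le_one_of_mem_closedPolyball hA) (c := c ^ 2) fun r h0 h1 => ?_,
    (d ^ 2)⁻¹, by positivity, hlow⟩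
  refine norm_le_of_nonneg_of_le_smul_one
    (𝒜 := HTensor (FockTensor n) H →L[ℂ] HTensor (FockTensor n) H) (sq_nonneg c) ?_ (hAc r h0 h1)
  exact (ofReal_smul_nonneg (𝒜 := HTensor (FockTensor n) H →L[ℂ] HTensor (FockTensor n) H)
    (by positivity) zero_le_one).trans (hlow r h0 h1)

end Harnack

end Polyball

end

/-! ### The equivalences and the two parts of `0`. -/

theorem theorem1p4 {k : ℕ} (hk : 1 ≤ k) (n : Fin k → ℕ) (hn : ∀ i, 1 ≤ n i)
    {H : Type*} [NormedAddCommGroup H] [InnerProductSpace ℂ H] [CompleteSpace H] :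
    (∀ A ∈ Polyball.closedPolyball n H,
      List.TFAE [
        Polyball.HarnackEquiv A 0,
        (∀ i, ∃ ρ : ℝ, Polyball.HasJointSpectralRadius (A i) ρ ∧ ρ < 1) ∧
          ∃ a : ℝ, 0 < a ∧ ∀ r : ℝ, 0 ≤ r → r < 1 →
            (a : ℂ) • (1 : Polyball.HTensor (Polyball.FockTensor n) H →L[ℂ]
              Polyball.HTensor (Polyball.FockTensor n) H)
              ≤ Polyball.poissonKernel ((r : ℂ) • A),
        A ∈ Polyball.openPolyball n H,
        Polyball.PoissonEquiv A 0]) ∧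
    Polyball.harnackPart n H 0 = Polyball.openPolyball n H ∧
    Polyball.poissonPart n H 0 = Polyball.openPolyball n H := by
  have h14 : ∀ A : Polyball.OpTuple n H,
      Polyball.HarnackEquiv A 0 → Polyball.PoissonEquiv A 0 :=
    fun A h => ⟨h.1.poissonDominated, h.2.poissonDominated⟩
  have h31 : ∀ A ∈ Polyball.openPolyball n H, Polyball.HarnackEquiv A 0 :=
    fun A => Polyball.harnackEquiv_zero_of_mem_openPolyball
  have h43 : ∀ A ∈ Polyball.closedPolyball n H, Polyball.PoissonEquiv A 0 →
      A ∈ Polyball.openPolyball n H := fun A hA h => by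
    obtain ⟨hp, a, ha, hP⟩ := h.mem_openPolyball_conditions hA
    exact Polyball.mem_openPolyball_of_le_poissonKernel hA hp ha hP
  refine ⟨fun A hA => ?_, ?_, ?_⟩
  · tfae_have 1 → 4 := h14 A
    tfae_have 3 → 1 := h31 A
    tfae_have 4 → 2 := fun h => by
      obtain ⟨hp, ha⟩ := h.mem_openPolyball_conditions hA
      exact ⟨fun i => Polyball.exists_hasJointSpectralRadius_lt_one_iff.2 (hp i), ha⟩
    tfae_have 2 → 3 := fun ⟨h, a, ha, hP⟩ => Polyball.mem_openPolyball_of_le_poissonKernel hA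
      (fun i => Polyball.exists_hasJointSpectralRadius_lt_one_iff.1 (h i)) ha hP
    tfae_finish
  · ext A
    exact ⟨fun h => h43 A h.1 (h14 A h.2), fun h => ⟨subset_closure h, h31 A h⟩⟩
  · ext A
    exact ⟨fun h => h43 A h.1 h.2, fun h => ⟨subset_closure h, h14 A (h31 A h)⟩⟩
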